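/- A \emph{contact$^-$ poset} is a structure $(P,0,\le,\delta)$ where $(P,\le)$ is a partially ordered set with minimum $0$ and $\delta$ is a binary relation on $P$ such that, for all $a,b,a_1,b_1,n\in P$: (Sym) $a\mathrel\delta b \Leftrightarrow b\mathrel\delta a$; (Emp) $a\mathrel\delta b \Rightarrow a>0$ and $b>0$; (Ext) $a\mathrel\delta b$, $a\le a_1$ and $b\le b_1$ imply $a_1\mathrel\delta b_1$; (Ref) $n\ne 0\Rightarrow n\mathrel\delta n$. A (not necessarily additive) \emph{contact$^-$ semilattice} is a structure $(P,0,+,\delta)$ where $(P,+)$ is a join semilattice with minimum $0$, ordered by $a\le b\Leftrightarrow a+b=b$, and $\delta$ satisfies the same four conditions. Let $T$ be either the first-order theory of contact$^-$ posets in the language $\{0,\le,\delta\}$ or the first-order theory of contact$^-$ semilattices in the language $\{0,+,\delta\}$; embeddings are the model-theoretic ones. \textbf{Theorem 5.} In each of the two cases the following hold. (1) The class of models of $T$ has the superamalgamation property: for all models $A,B,C$ of $T$ and embeddings $f:C\to A$, $g:C\to B$ there are a model $D$ of $T$ and embeddings $h:A\to D$, $k:B\to D$ with $hf=kg$ and $h(A)\cap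 k(B)=hf(C)$, such that for all $a\in A$ and $b\in B$: if $h(a)\le k(b)$, then there is $c\in C$ with $a\le f(c)$ and $g(c)\le b$; and if $k(b)\le h(a)$, then there is $c\in C$ with $b\le g(c)$ and $f(c)\le a$. (2) The class of finite models of $T$ has a Fraïssé limit $M$, that is, a countable ultrahomogeneous structure whose finitely generated substructures are, up to isomorphism, exactly the finite models of $T$. (3) The first-order theory $\mathrm{Th}(M)$ is $\omega$-categorical (it has exactly one countably infinite model up to isomorphism), has quantifier elimination, and is the model completion of $T$: it is a model complete theory extending $T$, every model of $T$ embeds in a model of $\mathrm{Th}(M)$, and for every model $A$ of $T$ the theory $\mathrm{Th}(M)\cup\mathrm{Diag}(A)$ is complete, where $\mathrm{Diag}(A)$ is the diagram of $A$, i.e. the set of atomic and negated atomic sentences, with constants for the elements of $A$, which are true in $A$. -/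

import Mathlib

universe u v w

open FirstOrder FirstOrder.Language CategoryTheory
open scoped FirstOrder

/-! ### General model theory -/

namespace FirstOrder.Language

/-- The superamalgamation property for the class of models of `T`, where `le` is the order carried
by the models: two extensions `A`, `B` of a common model `C` can be jointly embedded in a model `D`,
so that they agree on `C`, the images of `A` and `B` meet exactly in the image of `C`, and each
inequality in `D` between an element of `A` and one of `B` is witnessed by an element of `C`. -/
def Superamalgamation {L : Language.{u, v}} (T : L.Theory)
    (le : ∀ (M : Type w) [L.Structure M], M → M → Prop) : Prop :=
  ∀ (A B C : Bundled.{w} L.Structure), A ⊨ T → B ⊨ T → C ⊨ T →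
    ∀ (f : C ↪[L] A) (g : C ↪[L] B),
      ∃ (D : Bundled.{w} L.Structure) (h : A ↪[L] D) (k : B ↪[L] D),
        D ⊨ T ∧
        (∀ c : C, h (f c) = k (g c)) ∧
        (∀ (a : A) (b : B), h a = k b → ∃ c : C, f c = a ∧ g c = b) ∧
        (∀ (a : A) (b : B), le D (h a) (k b) → ∃ c : C, le A a (f c) ∧ le B (g c) b) ∧
        (∀ (a : A) (b : B), le D (k b) (h a) → ∃ c : C, le B b (g c) ∧ le A (f c) a)

/-- The class of finite models of a theory. -/
def finiteModels {L : Language.{u, v}} (T : L.Theory) : Set (Bundled.{w} L.Structure) :=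
  {S | Finite S ∧ S ⊨ T}

namespace Theory

variable {L : Language.{u, v}}

/-- A theory is `ω`-categorical if it has exactly one model of cardinality `ℵ₀`, up to
isomorphism. -/
def IsOmegaCategorical (T : L.Theory) : Prop :=
  (∃ M : ModelType.{u, v, w} T, Cardinal.mk M = Cardinal.aleph0) ∧
    Cardinal.Categorical (Cardinal.aleph0 : Cardinal.{w}) T

/-- A theory has quantifier elimination if, modulo the theory, each formula is equivalent to a
quantifier-free formula in the same free variables. -/
def HasQuantifierElimination (T : L.Theory) : Prop :=
  ∀ (n : ℕ) (φ : L.Formula (Fin n)), ∃ ψ : L.Formula (Fin n), ψ.IsQF ∧ T ⊨ᵇ φ.iff ψ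

/-- A theory is model complete if each embedding between its models is elementary. -/
def IsModelComplete (T : L.Theory) : Prop :=
  ∀ (M N : ModelType.{u, v, w} T) (f : M ↪[L] N) (n : ℕ) (φ : L.Formula (Fin n)) (x : Fin n → M),
    φ.Realize (f ∘ x) ↔ φ.Realize x

/-- The diagram of `A`: the atomic and negated atomic sentences, with a constant for each element
of `A`, which hold in `A`. -/
def diagram (L : Language.{u, v}) (A : Type w) [L.Structure A] : L[[A]].Theory :=
  {φ | A ⊨ φ ∧ (φ.IsAtomic ∨ ∃ ψ : L[[A]].Sentence, ψ.IsAtomic ∧ φ = ψ.not)}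

/-- `T'` is the model completion of `T`: it is a model complete theory extending `T`, each model of
`T` can be embedded in a model of `T'`, and `T'` together with the diagram of any model of `T`
is a complete theory. -/
structure IsModelCompletion (T' T : L.Theory) : Prop where
  extends_base : ∀ φ ∈ T, T' ⊨ᵇ φ
  modelComplete : IsModelComplete.{u, v, w} T'
  exists_embedding : ∀ A : ModelType.{u, v, w} T,
    ∃ N : ModelType.{u, v, w} T', Nonempty (A ↪[L] N)
  complete_diagram : ∀ A : ModelType.{u, v, w} T,
    ((L.lhomWithConstants A).onTheory T' ∪ diagram L A).IsComplete

end Theory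

end FirstOrder.Language

/-! ### Contact posets -/

namespace ContactPoset

/-- The function symbols of contact posets: a constant for the minimum. -/
inductive Func : ℕ → Type
  | zero : Func 0

/-- The relation symbols of contact posets: the order and the contact relation. -/
inductive Rel : ℕ → Type
  | le : Rel 2
  | contact : Rel 2

/-- The language of contact posets, with symbols `0`, `≤`, `δ`. -/
def lang : FirstOrder.Language.{0, 0} := ⟨Func, Rel⟩

/-- The symbol `0`. -/
def zeroSymb : lang.Constants := Func.zero

/-- The symbol `≤`. -/
def leSymb : lang.Relations 2 := Rel.le

/-- The symbol `δ`. -/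
def contactSymb : lang.Relations 2 := Rel.contact

instance : Countable (Σ l, lang.Functions l) :=
  Function.Injective.countable (f := fun _ => ()) (by rintro ⟨_, ⟨⟩⟩ ⟨_, ⟨⟩⟩ _; rfl)

/-- The minimum. -/
def zero (M : Type w) [lang.Structure M] : M := (zeroSymb : M)

/-- The order. -/
def Le (M : Type w) [lang.Structure M] (a b : M) : Prop :=
  Structure.RelMap leSymb ![a, b]

/-- The contact relation. -/
def Contact (M : Type w) [lang.Structure M] (a b : M) : Prop :=
  Structure.RelMap contactSymb ![a, b]

section Formulas

variable {n : ℕ}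

/-- The term `0`. -/
def zeroT : lang.Term (Empty ⊕ Fin n) := Constants.term zeroSymb

/-- The formula `s ≤ t`. -/
def leF (s t : lang.Term (Empty ⊕ Fin n)) : lang.BoundedFormula Empty n :=
  Relations.boundedFormula₂ leSymb s t

/-- The formula `s < t`. -/
def ltF (s t : lang.Term (Empty ⊕ Fin n)) : lang.BoundedFormula Empty n :=
  leF s t ⊓ ∼(s =' t)

/-- The formula `s δ t`. -/
def conF (s t : lang.Term (Empty ⊕ Fin n)) : lang.BoundedFormula Empty n :=
  Relations.boundedFormula₂ contactSymb s t

end Formulas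

/-- The theory of (not necessarily additive) contact posets with `0`. In turn: reflexivity,
transitivity, antisymmetry, minimum, (Sym), (Emp), (Ext), (Ref). -/
def theory : lang.Theory :=
  {∀' leF (&0) (&0),
   ∀' ∀' ∀' (leF (&0) (&1) ⊓ leF (&1) (&2) ⟹ leF (&0) (&2)),
   ∀' ∀' (leF (&0) (&1) ⊓ leF (&1) (&0) ⟹ (&0 =' &1)),
   ∀' leF zeroT (&0),
   ∀' ∀' (conF (&0) (&1) ⇔ conF (&1) (&0)),
   ∀' ∀' (conF (&0) (&1) ⟹ ltF zeroT (&0) ⊓ ltF zeroT (&1)),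
   ∀' ∀' ∀' ∀' (conF (&0) (&1) ⊓ leF (&0) (&2) ⊓ leF (&1) (&3) ⟹ conF (&2) (&3)),
   ∀' (∼(&0 =' zeroT) ⟹ conF (&0) (&0))}

/-- The models of the theory are exactly the contact posets. -/
theorem model_theory_iff (M : Type w) [lang.Structure M] :
    M ⊨ theory ↔
      (∀ a, Le M a a) ∧
      (∀ a b c, Le M a b → Le M b c → Le M a c) ∧
      (∀ a b, Le M a b → Le M b a → a = b) ∧
      (∀ a, Le M (zero M) a) ∧
      (∀ a b, Contact M a b ↔ Contact M b a) ∧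
      (∀ a b, Contact M a b →
        (Le M (zero M) a ∧ zero M ≠ a) ∧ (Le M (zero M) b ∧ zero M ≠ b)) ∧
      (∀ a b a₁ b₁, Contact M a b → Le M a a₁ → Le M b b₁ → Contact M a₁ b₁) ∧
      (∀ a, a ≠ zero M → Contact M a a) := by
  simp [theory, Theory.model_iff, Sentence.Realize, Formula.Realize, leF, ltF, conF, zeroT,
    BoundedFormula.realize_rel₂, Term.realize_constants, Fin.snoc, Le, Contact, zero]

end ContactPoset

/-! ### Contact semilattices -/

namespace ContactSemilattice

/-- The function symbols of contact semilattices: a constant for the minimum, and the join. -/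
inductive Func : ℕ → Type
  | zero : Func 0
  | add : Func 2

/-- The relation symbol of contact semilattices: the contact relation. -/
inductive Rel : ℕ → Type
  | contact : Rel 2

/-- The language of contact semilattices, with symbols `0`, `+`, `δ`. -/
def lang : FirstOrder.Language.{0, 0} := ⟨Func, Rel⟩

/-- The symbol `0`. -/
def zeroSymb : lang.Constants := Func.zero

/-- The symbol `+`. -/
def addSymb : lang.Functions 2 := Func.add

/-- The symbol `δ`. -/
def contactSymb : lang.Relations 2 := Rel.contact

instance : Countable (Σ l, lang.Functions l) :=
  Function.Injective.countable (f := fun s => s.1)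
    (by rintro ⟨_, ⟨⟩⟩ ⟨_, ⟨⟩⟩ h <;> first | rfl | simp at h)

/-- The minimum. -/
def zero (M : Type w) [lang.Structure M] : M := (zeroSymb : M)

/-- The join. -/
def add (M : Type w) [lang.Structure M] (a b : M) : M :=
  Structure.funMap addSymb ![a, b]

/-- The order associated to the join. -/
def Le (M : Type w) [lang.Structure M] (a b : M) : Prop := add M a b = b

/-- The contact relation. -/
def Contact (M : Type w) [lang.Structure M] (a b : M) : Prop :=
  Structure.RelMap contactSymb ![a, b]

section Formulas

variable {n : ℕ}

/-- The term `0`. -/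
def zeroT : lang.Term (Empty ⊕ Fin n) := Constants.term zeroSymb

/-- The term `s + t`. -/
def addT (s t : lang.Term (Empty ⊕ Fin n)) : lang.Term (Empty ⊕ Fin n) :=
  Functions.apply₂ addSymb s t

/-- The formula `s ≤ t`, that is, `s + t = t`. -/
def leF (s t : lang.Term (Empty ⊕ Fin n)) : lang.BoundedFormula Empty n := addT s t =' t

/-- The formula `s < t`. -/
def ltF (s t : lang.Term (Empty ⊕ Fin n)) : lang.BoundedFormula Empty n :=
  leF s t ⊓ ∼(s =' t)

/-- The formula `s δ t`. -/
def conF (s t : lang.Term (Empty ⊕ Fin n)) : lang.BoundedFormula Empty n :=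
  Relations.boundedFormula₂ contactSymb s t

end Formulas

/-- The theory of (not necessarily additive) contact join semilattices with `0`. In turn:
associativity, commutativity, idempotence, minimum, (Sym), (Emp), (Ext), (Ref). -/
def theory : lang.Theory :=
  {∀' ∀' ∀' (addT (addT (&0) (&1)) (&2) =' addT (&0) (addT (&1) (&2))),
   ∀' ∀' (addT (&0) (&1) =' addT (&1) (&0)),
   ∀' (addT (&0) (&0) =' &0),
   ∀' leF zeroT (&0),
   ∀' ∀' (conF (&0) (&1) ⇔ conF (&1) (&0)),
   ∀' ∀' (conF (&0) (&1) ⟹ ltF zeroT (&0) ⊓ ltF zeroT (&1)),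
   ∀' ∀' ∀' ∀' (conF (&0) (&1) ⊓ leF (&0) (&2) ⊓ leF (&1) (&3) ⟹ conF (&2) (&3)),
   ∀' (∼(&0 =' zeroT) ⟹ conF (&0) (&0))}

/-- The models of the theory are exactly the contact semilattices. -/
theorem model_theory_iff (M : Type w) [lang.Structure M] :
    M ⊨ theory ↔
      (∀ a b c, add M (add M a b) c = add M a (add M b c)) ∧
      (∀ a b, add M a b = add M b a) ∧
      (∀ a, add M a a = a) ∧
      (∀ a, Le M (zero M) a) ∧
      (∀ a b, Contact M a b ↔ Contact M b a) ∧
      (∀ a b, Contact M a b →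
        (Le M (zero M) a ∧ zero M ≠ a) ∧ (Le M (zero M) b ∧ zero M ≠ b)) ∧
      (∀ a b a₁ b₁, Contact M a b → Le M a a₁ → Le M b b₁ → Contact M a₁ b₁) ∧
      (∀ a, a ≠ zero M → Contact M a a) := by
  simp [theory, Theory.model_iff, Sentence.Realize, Formula.Realize, leF, ltF, conF, zeroT, addT,
    BoundedFormula.realize_rel₂, Term.realize_functions_apply₂, Term.realize_constants, Fin.snoc,
    Le, add, Contact, zero]

end ContactSemilattice

/-!
Let `C` be embedded in `A` and `B`. The pairs of lower sets (of ideals, for semilattices) of `A` and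
`B` which have the same trace on `C`, ordered by inclusion, form a superamalgam. Two such pairs are
declared to be in contact if their components in `A`, or those in `B`, contain elements which are in
contact; this restricts to the given relations because `C` inherits its contact from both sides.

The finite models therefore form a Fraïssé class. As finitely many terms suffice to express all
terms in given variables and the language is finite, each atomic type of tuples is isolated by a
quantifier-free formula. In the ultrahomogeneous limit `M`, tuples of the same atomic type are
conjugate, so that each formula is equivalent to a finite disjunction of isolating formulas. Given
quantifier elimination, a back-and-forth argument shows that `Th(M)` is `ω`-categorical. Since `M`
contains copies of the finitely generated substructures of any model, an ultrapower of `M` contains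
a copy of the model itself; by quantifier elimination, its diagram decides every sentence.
-/
namespace Fraisse

open Structure

variable {L : FirstOrder.Language.{u, v}}

section AtomicType

variable {α : Type*} {M N P : Type*} [L.Structure M] [L.Structure N] [L.Structure P]

/-- Two tuples, possibly in different structures, have the same atomic type if they satisfy the same
atomic formulas. The free variables of these formulas are the indices of the tuples. -/
structure SameAtomicType (L : FirstOrder.Language.{u, v}) {M N : Type*} [L.Structure M]
    [L.Structure N] (x : α → M) (y : α → N) : Prop where
  equal : ∀ s t : L.Term α, s.realize x = t.realize x ↔ s.realize y = t.realize y
  rel : ∀ {k : ℕ} (R : L.Relations k) (ts : Fin k → L.Term α),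
    RelMap R (fun i => (ts i).realize x) ↔ RelMap R (fun i => (ts i).realize y)

/-- The members of a tuple, as elements of the substructure which they generate. -/
def generators (L : FirstOrder.Language.{u, v}) {M : Type*} [L.Structure M] (x : α → M) :
    α → Substructure.closure L (Set.range x) :=
  fun i => ⟨x i, Substructure.subset_closure ⟨i, rfl⟩⟩

theorem subtype_comp_generators (x : α → M) :
    (Substructure.closure L (Set.range x)).subtype ∘ generators L x = x :=
  rfl

theorem exists_realize_generators_eq {x : α → M} (a : Substructure.closure L (Set.range x)) :
    ∃ t : L.Term α, t.realize (generators L x) = a := by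
  obtain ⟨t, ht⟩ := Substructure.mem_closure_iff_exists_term.1 a.2
  choose i hi using fun z : Set.range x => z.2
  refine ⟨t.relabel i, (Substructure.subtype _).injective ?_⟩
  rw [← HomClass.realize_term, subtype_comp_generators, Term.realize_relabel,
    show x ∘ i = Subtype.val from funext hi]
  exact ht

theorem embedding_closure_ext {x : α → M} {f g : Substructure.closure L (Set.range x) ↪[L] N}
    (h : f ∘ generators L x = g ∘ generators L x) : f = g := by
  ext a
  obtain ⟨t, rfl⟩ := exists_realize_generators_eq a
  rw [← HomClass.realize_term, h, HomClass.realize_term]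

namespace SameAtomicType

variable {x : α → M} {y : α → N} {z : α → P}

theorem symm (h : SameAtomicType L x y) : SameAtomicType L y x :=
  ⟨fun s t => (h.equal s t).symm, fun R ts => (h.rel R ts).symm⟩

theorem trans (h : SameAtomicType L x y) (h' : SameAtomicType L y z) : SameAtomicType L x z :=
  ⟨fun s t => (h.equal s t).trans (h'.equal s t), fun R ts => (h.rel R ts).trans (h'.rel R ts)⟩

theorem of_embedding (f : M ↪[L] N) (x : α → M) : SameAtomicType L x (f ∘ x) where
  equal s t := by simp only [HomClass.realize_term, f.injective.eq_iff]
  rel R ts := by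
    simp only [HomClass.realize_term]
    exact (f.map_rel R _).symm

theorem generators_left (h : SameAtomicType L x y) : SameAtomicType L (generators L x) y :=
  (of_embedding (Substructure.subtype _) (generators L x)).trans h

theorem exists_embedding (h : SameAtomicType L x y) :
    ∃ e : Substructure.closure L (Set.range x) ↪[L] N, e ∘ generators L x = y := by
  have h' := h.generators_left
  choose t ht using exists_realize_generators_eq (L := L) (x := x)
  refine ⟨⟨⟨fun a => (t a).realize y, fun a b hab => ?_⟩, fun {n} f a => ?_, fun {n} R a => ?_⟩,
    funext fun i => (h'.equal _ (Term.var i)).1 (ht _)⟩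
  · rw [← ht a, ← ht b]
    exact (h'.equal _ _).2 hab
  · refine (h'.equal _ (Term.func f fun i => t (a i))).1 ?_
    simp only [ht, Term.realize_func]
  · simpa only [ht, Function.comp_def] using (h'.rel R fun i => t (a i)).symm

theorem realize_iff (h : SameAtomicType L x y) {φ : L.Formula α} (hφ : φ.IsQF) :
    φ.Realize x ↔ φ.Realize y := by
  obtain ⟨e, rfl⟩ := h.exists_embedding
  have hM := hφ.realize_embedding (Substructure.subtype _) (v := generators L x) (xs := default)
  have hN := hφ.realize_embedding e (v := generators L x) (xs := default)
  rw [Subsingleton.elim (_ ∘ default) default] at hM hN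
  exact hM.trans hN.symm

end SameAtomicType

theorem exists_equiv_comp_eq_of_sameAtomicType [Finite α] (hM : L.IsUltrahomogeneous M)
    {x y : α → M} (h : SameAtomicType L x y) : ∃ g : M ≃[L] M, g ∘ x = y := by
  obtain ⟨e, rfl⟩ := h.exists_embedding
  obtain ⟨g, rfl⟩ := hM _ (Substructure.fg_closure (Set.finite_range x)) e
  exact ⟨g, rfl⟩

end AtomicType

section ElementarilyEquivalent

variable {M N : Type*} [L.Structure M] [L.Structure N]

theorem elementarilyEquivalent_of_model_completeTheory [N ⊨ L.completeTheory M] : M ≅[L] N :=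
  elementarilyEquivalent_iff.2 fun φ => (realize_iff_of_model_completeTheory M N φ).symm

theorem forall_realize_iff_of_elementarilyEquivalent {α : Type*} [Finite α] (h : M ≅[L] N)
    (φ : L.Formula α) : (∀ x : α → M, φ.Realize x) ↔ ∀ x : α → N, φ.Realize x := by
  have := h.realize_sentence (Formula.iAlls α (φ.relabel (Sum.inr : α → Empty ⊕ α)))
  simpa only [Sentence.Realize, Formula.realize_iAlls, Formula.realize_relabel,
    Sum.elim_comp_inr] using this

theorem realize_term_eq_of_elementarilyEquivalent {α : Type*} [Finite α] (h : M ≅[L] N)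
    {s t : L.Term α} (hM : ∀ x : α → M, s.realize x = t.realize x) (x : α → N) :
    s.realize x = t.realize x := by
  have := forall_realize_iff_of_elementarilyEquivalent h (s.equal t)
  simp only [Formula.realize_equal] at this
  exact this.1 hM x

theorem sameAtomicType_default_of_elementarilyEquivalent (h : M ≅[L] N) :
    SameAtomicType L (default : Empty → M) (default : Empty → N) where
  equal s t := by simpa only [Sentence.Realize, Formula.realize_equal] using
    h.realize_sentence (s.equal t)
  rel R ts := by simpa only [Sentence.Realize, Formula.realize_rel] using
    h.realize_sentence (R.formula ts)

theorem nonempty_fgEquiv_of_elementarilyEquivalent (h : M ≅[L] N) : Nonempty (L.FGEquiv M N) := by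
  obtain ⟨e, -⟩ := (sameAtomicType_default_of_elementarilyEquivalent h).exists_embedding
  exact ⟨⟨⟨_, _, e.equivRange⟩, Substructure.fg_closure (Set.finite_range _)⟩⟩

end ElementarilyEquivalent

/-- A structure is uniformly locally finite if, for each finite set of variables, finitely many
terms suffice to obtain the values of all terms in these variables. -/
def UniformlyLocallyFinite (L : FirstOrder.Language.{u, v}) (M : Type*) [L.Structure M] : Prop :=
  ∀ (α : Type) [Finite α], ∃ F : Finset (L.Term α), ∀ t : L.Term α, ∃ s ∈ F,
    ∀ x : α → M, t.realize x = s.realize x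

namespace UniformlyLocallyFinite

variable {M N : Type*} [L.Structure M] [L.Structure N]

theorem of_elementarilyEquivalent (hM : UniformlyLocallyFinite L M) (h : M ≅[L] N) :
    UniformlyLocallyFinite L N := by
  intro α _
  obtain ⟨F, hF⟩ := hM α
  refine ⟨F, fun t => ?_⟩
  obtain ⟨s, hs, hst⟩ := hF t
  exact ⟨s, hs, realize_term_eq_of_elementarilyEquivalent h hst⟩

theorem of_varFinset
    (h : ∀ (α : Type) [DecidableEq α] (s t : L.Term α), s.varFinset = t.varFinset →
      ∀ x : α → M, s.realize x = t.realize x) : UniformlyLocallyFinite L M := by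
  classical
  intro α _
  let V : Set (Finset α) := Set.range (Term.varFinset : L.Term α → Finset α)
  choose r hr using fun V : V => V.2
  refine ⟨(Set.finite_range r).toFinset, fun t => ⟨r ⟨_, t, rfl⟩, by simp, ?_⟩⟩
  exact h α t _ (hr ⟨_, t, rfl⟩).symm

theorem finite_of_fg (h : UniformlyLocallyFinite L M) {S : L.Substructure M} (hS : S.FG) :
    Finite S := by
  obtain ⟨n, x, rfl⟩ := Substructure.fg_iff_exists_fin_generating_family.1 hS
  obtain ⟨F, hF⟩ := h (Fin n)
  refine Finite.of_surjective (fun t : F => t.1.realize (generators L x)) fun a => ?_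
  obtain ⟨t, rfl⟩ := exists_realize_generators_eq a
  obtain ⟨s, hs, hst⟩ := hF t
  refine ⟨⟨s, hs⟩, (Substructure.subtype _).injective ?_⟩
  simp only [← HomClass.realize_term, hst]

end UniformlyLocallyFinite

section Isolate

variable {α : Type*} {M N : Type*} [L.Structure M] [L.Structure N]

/-- Indices for the atomic formulas whose terms belong to `F`. -/
abbrev AtomIndex (F : Finset (L.Term α)) : Type _ :=
  (F × F) ⊕ (Σ R : (Σ k, L.Relations k), Fin R.1 → F)

variable {F : Finset (L.Term α)}

/-- The atomic formula with a given index. -/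
def atom : AtomIndex F → L.Formula α
  | .inl p => Term.equal p.1 p.2
  | .inr p => Relations.formula p.1.2 fun i => (p.2 i : L.Term α)

theorem isQF_atom (p : AtomIndex F) : (atom p).IsQF := by
  rcases p with p | p
  · exact (BoundedFormula.IsAtomic.equal _ _).isQF
  · exact (BoundedFormula.IsAtomic.rel _ _).isQF

/-- The atomic type of a tuple, restricted to formulas whose terms belong to `F`. -/
def atomsOf (F : Finset (L.Term α)) (x : α → M) : Set (AtomIndex F) :=
  {p | (atom p).Realize x}

theorem sameAtomicType_of_atomsOf_eq
    (hF : ∀ t : L.Term α, ∃ s ∈ F, (∀ x : α → M, t.realize x = s.realize x) ∧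
      ∀ y : α → N, t.realize y = s.realize y)
    {x : α → M} {y : α → N} (h : atomsOf F x = atomsOf F y) : SameAtomicType L x y := by
  choose r hrF hrM hrN using hF
  constructor
  · intro s t
    rw [hrM s, hrM t, hrN s, hrN t]
    simpa [atomsOf, atom] using Set.ext_iff.1 h (.inl (⟨r s, hrF s⟩, ⟨r t, hrF t⟩))
  · intro k R ts
    simp only [fun i => hrM (ts i) x, fun i => hrN (ts i) y]
    simpa [atomsOf, atom, Formula.realize_rel] using
      Set.ext_iff.1 h (.inr ⟨⟨k, R⟩, fun i => ⟨r (ts i), hrF (ts i)⟩⟩)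

theorem isQF_iInf {β : Type*} [Finite β] {n : ℕ} {f : β → L.BoundedFormula α n}
    (h : ∀ b, (f b).IsQF) : (BoundedFormula.iInf f).IsQF := by
  let _ := Fintype.ofFinite β
  change (((Finset.univ : Finset β).toList.map f).foldr (· ⊓ ·) ⊤).IsQF
  induction (Finset.univ : Finset β).toList with
  | nil => exact .top
  | cons b l ih => exact (h b).inf ih

theorem isQF_iSup {β : Type*} [Finite β] {n : ℕ} {f : β → L.BoundedFormula α n}
    (h : ∀ b, (f b).IsQF) : (BoundedFormula.iSup f).IsQF := by
  let _ := Fintype.ofFinite β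
  change (((Finset.univ : Finset β).toList.map f).foldr (· ⊔ ·) ⊥).IsQF
  induction (Finset.univ : Finset β).toList with
  | nil => exact .falsum
  | cons b l ih => exact (h b).sup ih

variable [Finite (Σ k, L.Relations k)]

open Classical in
/-- The formula which says that the atomic type of a tuple, restricted to `F`, is `τ`. -/
noncomputable def isolate (τ : Set (AtomIndex F)) : L.Formula α :=
  Formula.iInf fun p => if p ∈ τ then atom p else (atom p).not

theorem isQF_isolate (τ : Set (AtomIndex F)) : (isolate τ).IsQF := by
  refine isQF_iInf fun p => ?_
  split_ifs
  · exact isQF_atom p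
  · exact (isQF_atom p).not

theorem realize_isolate {τ : Set (AtomIndex F)} {x : α → M} :
    (isolate τ).Realize x ↔ atomsOf F x = τ := by
  rw [isolate, Formula.realize_iInf, Set.ext_iff]
  refine forall_congr' fun p => ?_
  split_ifs with hp <;> simp [atomsOf, hp]

end Isolate

section QuantifierElimination

theorem isModelComplete_of_hasQuantifierElimination {T : L.Theory}
    (hT : T.HasQuantifierElimination) : Theory.IsModelComplete.{u, v, w} T := by
  intro M N f n φ x
  obtain ⟨ψ, hψ, h⟩ := hT n φ
  rw [Formula.realize_iff.1 (h.realize_formula N), Formula.realize_iff.1 (h.realize_formula M)]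
  exact ((SameAtomicType.of_embedding f x).realize_iff hψ).symm

variable [Finite (Σ k, L.Relations k)]

theorem hasQuantifierElimination_of_isUltrahomogeneous {M : Type*} [L.Structure M]
    (hM : L.IsUltrahomogeneous M) (hfin : UniformlyLocallyFinite L M) :
    (L.completeTheory M).HasQuantifierElimination := by
  intro n φ
  obtain ⟨F, hF⟩ := hfin (Fin n)
  let P := {τ : Set (AtomIndex F) // ∃ x : Fin n → M, φ.Realize x ∧ atomsOf F x = τ}
  refine ⟨Formula.iSup fun τ : P => isolate τ.1, isQF_iSup fun τ => isQF_isolate _, ?_⟩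
  rw [Theory.models_formula_iff]
  intro N
  refine (forall_realize_iff_of_elementarilyEquivalent
    (elementarilyEquivalent_of_model_completeTheory (M := M)) _).1 fun x => ?_
  simp only [Formula.realize_iff, Formula.realize_iSup, realize_isolate]
  constructor
  · exact fun hx => ⟨⟨_, x, hx, rfl⟩, rfl⟩
  · rintro ⟨⟨τ, y, hy, rfl⟩, hxy⟩
    obtain ⟨g, rfl⟩ := exists_equiv_comp_eq_of_sameAtomicType hM
      (sameAtomicType_of_atomsOf_eq (fun t => by simpa using hF t) hxy.symm)
    exact (StrongHomClass.realize_formula g φ).2 hy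

variable {N N' : Type*} [L.Structure N] [L.Structure N'] [Nonempty N]

theorem exists_sameAtomicType_sumElim (hQE : (L.completeTheory N).HasQuantifierElimination)
    (hfin : UniformlyLocallyFinite L N) (hNN' : N ≅[L] N') {n : ℕ} {x : Fin n → N}
    {y : Fin n → N'} (hxy : SameAtomicType L x y) (a : Unit → N) :
    ∃ b : Unit → N', SameAtomicType L (Sum.elim x a) (Sum.elim y b) := by
  have : Nonempty N' := hNN'.nonempty
  have : N' ⊨ L.completeTheory N := hNN'.theory_model
  obtain ⟨F, hF⟩ := hfin (Fin n ⊕ Unit)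
  let χ : L.Formula (Fin n) := Formula.iExs Unit (isolate (atomsOf F (Sum.elim x a)))
  obtain ⟨ψ, hψ, h⟩ := hQE n χ
  have hx : χ.Realize x := Formula.realize_iExs.2 ⟨a, realize_isolate.2 rfl⟩
  have hy : χ.Realize y := by
    rw [Formula.realize_iff.1 (h.realize_formula N')]
    rwa [Formula.realize_iff.1 (h.realize_formula N), hxy.realize_iff hψ] at hx
  obtain ⟨b, hb⟩ := Formula.realize_iExs.1 hy
  refine ⟨b, sameAtomicType_of_atomsOf_eq (fun t => ?_) (realize_isolate.1 hb).symm⟩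
  obtain ⟨s, hs, hst⟩ := hF t
  exact ⟨s, hs, hst, realize_term_eq_of_elementarilyEquivalent hNN' hst⟩

theorem isExtensionPair_of_hasQuantifierElimination
    (hQE : (L.completeTheory N).HasQuantifierElimination) (hfin : UniformlyLocallyFinite L N)
    (hNN' : N ≅[L] N') : L.IsExtensionPair N N' := by
  rw [isExtensionPair_iff_exists_embedding_closure_singleton_sup]
  intro S hS f a
  obtain ⟨n, x, rfl⟩ := Substructure.fg_iff_exists_fin_generating_family.1 hS
  have hxf : SameAtomicType L x (f ∘ generators L x) :=
    (SameAtomicType.of_embedding (Substructure.subtype _) (generators L x)).symm.trans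
      (.of_embedding f _)
  obtain ⟨b, hb⟩ := exists_sameAtomicType_sumElim hQE hfin hNN' hxf fun _ => a
  obtain ⟨e, he⟩ := hb.exists_embedding
  have hle : Substructure.closure L {a} ⊔ Substructure.closure L (Set.range x) ≤
      Substructure.closure L (Set.range (Sum.elim x fun _ : Unit => a)) := by
    rw [← Substructure.closure_union, Set.Sum.elim_range, Set.range_const, Set.union_comm]
  refine ⟨e.comp (Substructure.inclusion hle), embedding_closure_ext (funext fun i => ?_)⟩
  exact (congrFun he (Sum.inl i)).symm

theorem isOmegaCategorical_of_hasQuantifierElimination {M : Type w} [L.Structure M] [Countable M]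
    [Infinite M]
    (hQE : (L.completeTheory M).HasQuantifierElimination) (hfin : UniformlyLocallyFinite L M) :
    Theory.IsOmegaCategorical.{u, v, w} (L.completeTheory M) := by
  refine ⟨⟨Theory.ModelType.of _ M, Cardinal.mk_eq_aleph0 M⟩, fun N N' hN hN' => ?_⟩
  have : Countable N := Cardinal.mk_le_aleph0_iff.1 hN.le
  have : Countable N' := Cardinal.mk_le_aleph0_iff.1 hN'.le
  have hMN : M ≅[L] N := elementarilyEquivalent_of_model_completeTheory
  have hMN' : M ≅[L] N' := elementarilyEquivalent_of_model_completeTheory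
  have hNN' : N ≅[L] N' := hMN.symm.trans hMN'
  obtain ⟨g⟩ := nonempty_fgEquiv_of_elementarilyEquivalent hNN'
  obtain ⟨f, -⟩ := equiv_between_cg cg_of_countable cg_of_countable g
    (isExtensionPair_of_hasQuantifierElimination (hMN.completeTheory_eq ▸ hQE)
      (hfin.of_elementarilyEquivalent hMN) hNN')
    (isExtensionPair_of_hasQuantifierElimination (hMN'.completeTheory_eq ▸ hQE)
      (hfin.of_elementarilyEquivalent hMN') hNN'.symm)
  exact ⟨f⟩

end QuantifierElimination

section Diagram

variable {A : Type*}

theorem isAtomic_equivSentence {φ : L.Formula A} (hφ : φ.IsAtomic) :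
    (Formula.equivSentence φ).IsAtomic := by
  cases hφ with
  | equal s t => exact .equal _ _
  | rel R ts => exact .rel _ _

variable [L.Structure A] {N : Type*} [L.Structure N]

theorem realize_iff_of_model_diagram [L[[A]].Structure N]
    [(L.lhomWithConstants A).IsExpansionOn N] [hN : N ⊨ Theory.diagram L A] {φ : L.Formula A}
    (hφ : φ.IsAtomic) : φ.Realize (id : A → A) ↔ φ.Realize fun a => (L.con a : N) := by
  have hA : A ⊨ Formula.equivSentence φ ↔ φ.Realize id := Formula.realize_equivSentence A φ
  rw [← hA, ← Formula.realize_equivSentence N φ]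
  have hφ' := isAtomic_equivSentence hφ
  by_cases h : A ⊨ Formula.equivSentence φ
  · exact iff_of_true h (hN.realize_of_mem _ ⟨h, .inl hφ'⟩)
  · refine iff_of_false h ((Sentence.realize_not N).1 (hN.realize_of_mem _ ?_))
    exact ⟨(Sentence.realize_not A).2 h, .inr ⟨_, hφ', rfl⟩⟩

theorem sameAtomicType_of_model_diagram [L[[A]].Structure N]
    [(L.lhomWithConstants A).IsExpansionOn N] [N ⊨ Theory.diagram L A] :
    SameAtomicType L (id : A → A) fun a => (L.con a : N) where
  equal s t := by
    simpa only [Formula.realize_equal] using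
      realize_iff_of_model_diagram (φ := s.equal t) (.equal _ _)
  rel R ts := by
    simpa only [Formula.realize_rel] using
      realize_iff_of_model_diagram (φ := R.formula ts) (.rel _ _)

theorem model_diagram_of_embedding (e : A ↪[L] N) :
    letI := constantsOn.structure e
    N ⊨ Theory.diagram L A := by
  let _ := constantsOn.structure e
  let e' : A ↪[L[[A]]] N :=
    { toEmbedding := e.toEmbedding
      map_fun' := by
        rintro n (f | f) x
        · exact e.map_fun f x
        · cases n with
          | zero => rfl
          | succ n => exact f.elim
      map_rel' := by
        rintro n (R | R) x
        · exact e.map_rel R x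
        · exact R.elim }
  have realize_iff {φ : L[[A]].Sentence} (hφ : φ.IsQF) : N ⊨ φ ↔ A ⊨ φ := by
    have := hφ.realize_embedding e' (v := default) (xs := default)
    rwa [Subsingleton.elim (e' ∘ default) default, Subsingleton.elim (e' ∘ default) default] at this
  refine ⟨fun φ hφ => ?_⟩
  obtain ⟨hφ, hA | ⟨ψ, hA, rfl⟩⟩ := hφ
  · exact (realize_iff hA.isQF).2 hφ
  · exact (realize_iff hA.isQF.not).2 hφ

end Diagram

section CompleteDiagram

variable {T : L.Theory}

theorem exists_isQF_forall_realize_iff (hT : T.HasQuantifierElimination) {α : Type*}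
    (φ : L.Formula α) :
    ∃ ψ : L.Formula α, ψ.IsQF ∧
      ∀ (N : Type*) [L.Structure N] [Nonempty N] [N ⊨ T] (x : α → N),
        φ.Realize x ↔ ψ.Realize x := by
  classical
  let ε := φ.freeVarFinset.equivFin
  obtain ⟨ψ, hψ, h⟩ := hT _ (φ.restrictFreeVar ε : L.Formula _)
  refine ⟨ψ.relabel fun i => (ε.symm i : α), hψ.relabel _, fun N _ _ _ x => ?_⟩
  rw [Formula.realize_relabel, ← Formula.realize_iff.1 (h.realize_formula N)]
  exact (BoundedFormula.realize_restrictFreeVar _ (by simp)).symm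

theorem isComplete_diagram_of_hasQuantifierElimination (hT : T.HasQuantifierElimination)
    {A : Type w} [L.Structure A] [Nonempty A] {N : Type*} [L.Structure N] [N ⊨ T] (e : A ↪[L] N) :
    ((L.lhomWithConstants A).onTheory T ∪ Theory.diagram L A).IsComplete := by
  refine ⟨?_, fun φ => ?_⟩
  · let _ := constantsOn.structure e
    have : Nonempty N := .map e inferInstance
    have : N ⊨ (L.lhomWithConstants A).onTheory T ∪ Theory.diagram L A :=
      ((LHom.onTheory_model _ _).2 inferInstance).union (model_diagram_of_embedding e)
    exact Theory.Model.isSatisfiable N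
  · obtain ⟨ψ, hψ, h⟩ := exists_isQF_forall_realize_iff hT (Formula.equivSentence.symm φ)
    have realize_iff
        (N : Theory.ModelType ((L.lhomWithConstants A).onTheory T ∪ Theory.diagram L A)) :
        N ⊨ φ ↔ ψ.Realize (id : A → A) := by
      have : N ⊨ Theory.diagram L A := N.is_model.mono Set.subset_union_right
      let _ := (L.lhomWithConstants A).reduct N
      have : N ⊨ T := (LHom.onTheory_model (L.lhomWithConstants A) T).1
        (N.is_model.mono Set.subset_union_left)
      rw [← Formula.realize_equivSentence_symm_con, h]
      exact ((sameAtomicType_of_model_diagram (N := N)).realize_iff hψ).symm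
    by_cases hA : ψ.Realize (id : A → A)
    · exact .inl (Theory.models_sentence_iff.2 fun N => (realize_iff N).2 hA)
    · exact .inr (Theory.models_sentence_iff.2 fun N =>
        (Sentence.realize_not N).2 fun hN => hA ((realize_iff N).1 hN))

end CompleteDiagram

section Ultraproduct

variable {I : Type*} {U : Ultrafilter I} {M : I → Type*} [∀ i, L.Structure (M i)]
  {A : Type*} [L.Structure A]

theorem nonempty_embedding_product_of_eventually (e : A → ∀ i, M i)
    (hinj : ∀ a b, a ≠ b → ∀ᶠ i in U, e a i ≠ e b i)
    (hfun : ∀ {n : ℕ} (f : L.Functions n) (x : Fin n → A),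
      ∀ᶠ i in U, e (funMap f x) i = funMap f fun j => e (x j) i)
    (hrel : ∀ {n : ℕ} (r : L.Relations n) (x : Fin n → A),
      ∀ᶠ i in U, RelMap r (fun j => e (x j) i) ↔ RelMap r x) :
    Nonempty (A ↪[L] (U : Filter I).Product M) := by
  let N := (U : Filter I).Product M
  refine ⟨⟨⟨fun a => (e a : N), fun a b hab => ?_⟩, fun {n} f x => ?_, fun {n} r x => ?_⟩⟩
  · by_contra hne
    have heq : ∀ᶠ i in U, e a i = e b i := Quotient.eq''.1 hab
    obtain ⟨i, hi, hi'⟩ := (heq.and (hinj a b hne)).exists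
    exact hi' hi
  · exact (Quotient.sound (hfun f x) : (e (funMap f x) : N) =
      (fun i => funMap f fun j => e (x j) i : N)).trans (Ultraproduct.funMap_cast f _).symm
  · have := relMap_quotient_mk' (s := (U : Filter I).productSetoid M) r fun j => e (x j)
    refine this.trans ?_
    change (∀ᶠ i in U, RelMap r fun j => e (x j) i) ↔ _
    rw [Filter.eventually_congr (hrel r x), Filter.eventually_const]

theorem nonempty_embedding_product_of_substructures [∀ i, Nonempty (M i)] (S : I → L.Substructure A)
    (hS : ∀ a, ∀ᶠ i in U, a ∈ S i) (g : ∀ i, S i ↪[L] M i) :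
    Nonempty (A ↪[L] (U : Filter I).Product M) := by
  classical
  let e : A → ∀ i, M i := fun a i => if h : a ∈ S i then g i ⟨a, h⟩ else Classical.arbitrary _
  have he {i : I} {a : A} (h : a ∈ S i) : e a i = g i ⟨a, h⟩ := dif_pos h
  have hSx {n : ℕ} (x : Fin n → A) : ∀ᶠ i in U, ∀ j, x j ∈ S i :=
    Filter.eventually_all.2 fun j => hS (x j)
  refine nonempty_embedding_product_of_eventually e (fun a b hab => ?_) (fun f x => ?_)
    fun r x => ?_
  · filter_upwards [hS a, hS b] with i ha hb h
    rw [he ha, he hb] at h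
    exact hab (congrArg Subtype.val ((g i).injective h))
  · filter_upwards [hSx x] with i hi
    rw [he ((S i).fun_mem f x hi), funext fun j => he (hi j)]
    exact (g i).map_fun f fun j => ⟨x j, hi j⟩
  · filter_upwards [hSx x] with i hi
    rw [funext fun j => he (hi j)]
    exact (g i).map_rel r fun j => ⟨x j, hi j⟩

end Ultraproduct

theorem exists_embedding_model_completeTheory {A M : Type w} [L.Structure A] [L.Structure M]
    [Nonempty M] (h : ∀ S : L.Substructure A, S.FG → Nonempty (S ↪[L] M)) :
    ∃ N : Theory.ModelType.{u, v, w} (L.completeTheory M), Nonempty (A ↪[L] N) := by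
  let U : Ultrafilter (Finset A) := Ultrafilter.of Filter.atTop
  let N := (U : Filter (Finset A)).Product fun _ => M
  have hN : N ⊨ L.completeTheory M := ⟨fun φ hφ =>
    (Ultraproduct.sentence_realize φ).2 (Filter.Eventually.of_forall fun _ => hφ)⟩
  refine ⟨Theory.ModelType.of _ N, nonempty_embedding_product_of_substructures
    (fun s => Substructure.closure L (s : Set A)) (fun a => ?_)
    fun s => (h _ (Substructure.fg_closure s.finite_toSet)).some⟩
  refine Filter.Eventually.filter_mono (Ultrafilter.of_le _) ?_
  filter_upwards [Filter.eventually_ge_atTop {a}] with s hs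
  exact Substructure.subset_closure (hs (Finset.mem_singleton_self a))

theorem realize_of_isUniversal {M : Type*} [L.Structure M] {n : ℕ}
    {φ : L.BoundedFormula Empty n} (hφ : φ.IsUniversal) (x : Fin n → M)
    (h : ∀ (S : L.Substructure M), S.FG → ∀ y : Fin n → S, (fun i => (y i : M)) = x →
      φ.Realize default y) : φ.Realize default x := by
  induction hφ with
  | of_isQF hQF =>
    have := (hQF.realize_embedding (Substructure.subtype _) (v := default)
      (xs := generators L x)).2 (h _ (Substructure.fg_closure (Set.finite_range x)) _ rfl)
    rwa [Subsingleton.elim (_ ∘ default) default] at this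
  | all _ ih =>
    rw [BoundedFormula.realize_all]
    intro a
    refine ih _ fun S hS y hy => ?_
    have := h S hS (fun i => y i.castSucc)
      (funext fun i => by simpa using congrFun hy i.castSucc)
    rw [BoundedFormula.realize_all] at this
    convert! this (y (Fin.last _))
    exact (Fin.snoc_init_self y).symm

theorem model_of_forall_fg_model {T : L.Theory} [hT : T.IsUniversal] {M : Type*} [L.Structure M]
    (h : ∀ S : L.Substructure M, S.FG → S ⊨ T) : M ⊨ T := by
  refine ⟨fun φ hφ => realize_of_isUniversal (hT.isUniversal_of_mem hφ) default fun S hS y _ => ?_⟩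
  have := (h S hS).realize_of_mem φ hφ
  rwa [Subsingleton.elim y default]

section FraisseLimit

variable {K : Set (Bundled.{w} L.Structure)}

/-- An extension `j` of a structure `N` absorbs `B` if every amalgamation problem for `N` and `B`
is solved in this extension. -/
def Absorbs {N N' : Type w} [L.Structure N] [L.Structure N'] (j : N ↪[L] N') (B : Type w)
    [L.Structure B] : Prop :=
  ∀ (A : Type w) [L.Structure A] (i : A ↪[L] B) (e : A ↪[L] N),
    ∃ e' : B ↪[L] N', e'.comp i = j.comp e

/-- A structure `M` is rich for `K` if every embedding in `M` of a finitely generated structure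
extends to each member of `K` which contains that structure. -/
def IsRich (K : Set (Bundled.{w} L.Structure)) (M : Type w) [L.Structure M] : Prop :=
  ∀ B ∈ K, ∀ (A : Type w) [L.Structure A], FG L A → ∀ (i : A ↪[L] B) (e : A ↪[L] M),
    ∃ e' : B ↪[L] M, e'.comp i = e

theorem absorbs_of_forall_substructure {N N' B : Type w} [L.Structure N] [L.Structure N']
    [L.Structure B] {j : N ↪[L] N'}
    (h : ∀ (S : L.Substructure B) (e : S ↪[L] N), ∃ e' : B ↪[L] N', e'.comp S.subtype = j.comp e) :
    Absorbs j B := by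
  intro A _ i e
  obtain ⟨e', he'⟩ := h _ (e.comp i.equivRange.symm.toEmbedding)
  refine ⟨e', Embedding.ext fun a => ?_⟩
  simpa using DFunLike.congr_fun he' (i.equivRange a)

theorem Absorbs.of_equiv {N N' B B' : Type w} [L.Structure N] [L.Structure N'] [L.Structure B]
    [L.Structure B'] {j : N ↪[L] N'} (h : Absorbs j B) (ε : B' ≃[L] B) : Absorbs j B' := by
  intro A _ i e
  obtain ⟨e', he'⟩ := h A (ε.toEmbedding.comp i) e
  exact ⟨e'.comp ε.toEmbedding, he'⟩

theorem exists_absorbs (hher : Hereditary K) (hamal : Amalgamation K)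
    {N B : Bundled.{w} L.Structure} (hN : N ∈ K) (hB : B ∈ K) [Finite N] [Finite B] :
    ∃ N' ∈ K, ∃ j : N ↪[L] N', Absorbs j B := by
  classical
  let Problem := Σ S : L.Substructure B, S ↪[L] N
  have (S : L.Substructure B) : Finite (S ↪[L] N) := .of_injective _ DFunLike.coe_injective
  have : Finite (L.Substructure B) := .of_injective _ SetLike.coe_injective
  have := Fintype.ofFinite Problem
  suffices h : ∀ s : Finset Problem, ∃ N' ∈ K, ∃ j : N ↪[L] N', ∀ p ∈ s,
      ∃ e' : B ↪[L] N', e'.comp p.1.subtype = j.comp p.2 by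
    obtain ⟨N', hN', j, hj⟩ := h Finset.univ
    exact ⟨N', hN', j, absorbs_of_forall_substructure fun S e => hj ⟨S, e⟩ (Finset.mem_univ _)⟩
  intro s
  induction s using Finset.induction_on with
  | empty => exact ⟨N, hN, Embedding.refl L N, by simp⟩
  | insert p s _ ih =>
    obtain ⟨N', hN', j, hj⟩ := ih
    have hp : Bundled.mk p.1 ∈ K := hher B hB ⟨FG.of_finite, ⟨p.1.subtype⟩⟩
    obtain ⟨Q, f, g, hQ, hfg⟩ :=
      hamal (Bundled.mk p.1) N' B (j.comp p.2) p.1.subtype hp hN' hB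
    refine ⟨Q, hQ, f.comp j, fun q hq => ?_⟩
    rcases Finset.mem_insert.1 hq with rfl | hq
    · exact ⟨g, hfg.symm⟩
    · obtain ⟨e', he'⟩ := hj q hq
      exact ⟨f.comp e', by rw [Embedding.comp_assoc, he', Embedding.comp_assoc]⟩

theorem exists_absorbing_chain [hK : IsFraisse K] (hfin : ∀ N ∈ K, Finite N) :
    ∃ (G : ℕ → K) (f : ∀ n, (G n).1 ↪[L] (G (n + 1)).1),
      ∀ B ∈ K, ∀ n₀, ∃ n ≥ n₀, Absorbs (f n) B := by
  obtain ⟨F, hF⟩ := hK.is_essentially_countable.exists_eq_range (hK.is_nonempty.image _)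
  have hFK (n : ℕ) : ∃ B ∈ K, Quotient.mk' B = F n :=
    (hF ▸ Set.mem_range_self n : F n ∈ Quotient.mk' '' K)
  choose B hBK hBF using hFK
  have exists_equiv {N} (hN : N ∈ K) : ∃ n, Nonempty (N ≃[L] B n) := by
    obtain ⟨n, hn⟩ : Quotient.mk' N ∈ Set.range F := hF ▸ Set.mem_image_of_mem _ hN
    exact ⟨n, Quotient.exact (hn.symm.trans (hBF n).symm)⟩
  have exists_next (N : K) (n : ℕ) : ∃ N' ∈ K, ∃ j : N.1 ↪[L] N', Absorbs j (B n.unpair.1) :=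
    have := hfin _ N.2
    have := hfin _ (hBK n.unpair.1)
    exists_absorbs hK.hereditary hK.amalgamation N.2 (hBK _)
  choose next hnext j hj using exists_next
  let G : ℕ → K := Nat.rec ⟨B 0, hBK 0⟩ fun n N => ⟨next N n, hnext N n⟩
  refine ⟨G, fun n => j (G n) n, fun N hN n₀ => ?_⟩
  obtain ⟨m, ⟨ε⟩⟩ := exists_equiv hN
  refine ⟨Nat.pair m n₀, Nat.right_le_pair m n₀, (hj _ _).of_equiv ?_⟩
  rwa [Nat.unpair_pair]

section DirectLimit

variable {ι : Type*} [Preorder ι] [IsDirectedOrder ι] [Nonempty ι] {G : ι → Type w}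
  [∀ i, L.Structure (G i)] {f : ∀ i j, i ≤ j → G i ↪[L] G j}
  [DirectedSystem G fun i j h => f i j h]

theorem exists_comp_eq_of_embedding_directLimit {A : Type*} [L.Structure A] (hA : FG L A)
    (e : A ↪[L] Language.DirectLimit G f) :
    ∃ (i : ι) (e₀ : A ↪[L] G i), (Language.DirectLimit.of L ι G f i).comp e₀ = e := by
  obtain ⟨i, S, hS⟩ := Language.DirectLimit.exists_fg_substructure_in_Sigma e.toHom.range
    (hA.range _)
  have hle : e.toHom.range ≤ (Language.DirectLimit.of L ι G f i).toHom.range := by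
    rw [← hS, Hom.range_eq_map]
    exact Substructure.monotone_map le_top
  let o := (Language.DirectLimit.of L ι G f i).equivRange
  refine ⟨i, o.symm.toEmbedding.comp ((Substructure.inclusion hle).comp e.equivRange.toEmbedding),
    Embedding.ext fun a => ?_⟩
  exact congrArg Subtype.val (o.apply_symm_apply (Substructure.inclusion hle (e.equivRange a)))

end DirectLimit

theorem isRich_directLimit {G : ℕ → Type w} [∀ n, L.Structure (G n)]
    {f : ∀ n, G n ↪[L] G (n + 1)} (h : ∀ B ∈ K, ∀ n₀, ∃ n ≥ n₀, Absorbs (f n) B) :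
    IsRich K (Language.DirectLimit G (DirectedSystem.natLERec f)) := by
  intro B hB A _ hA i e
  let f' := DirectedSystem.natLERec f
  let o := Language.DirectLimit.of L ℕ G f'
  have hf' (n : ℕ) : f' n (n + 1) n.le_succ = f n := by
    ext x
    simp [f', Nat.leRecOn_succ']
  have hof {m n : ℕ} (hmn : m ≤ n) : (o n).comp (f' m n hmn) = o m :=
    Embedding.ext fun _ => Language.DirectLimit.of_f
  obtain ⟨m, e₀, rfl⟩ := exists_comp_eq_of_embedding_directLimit hA e
  obtain ⟨n, hmn, hn⟩ := h B hB m
  obtain ⟨e', he'⟩ := hn A i ((f' m n hmn).comp e₀)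
  refine ⟨(o (n + 1)).comp e', ?_⟩
  change _ = (o m).comp e₀
  rw [Embedding.comp_assoc, he', ← hf', ← hof hmn, ← hof n.le_succ]
  simp only [Embedding.comp_assoc]

theorem IsRich.isUltrahomogeneous {M : Type w} [L.Structure M] (hM : IsRich K M)
    (hage : L.age M ⊆ K) (hcg : CG L M) : L.IsUltrahomogeneous M := by
  rw [isUltrahomogeneous_iff_IsExtensionPair hcg,
    isExtensionPair_iff_exists_embedding_closure_singleton_sup]
  intro S hS f m
  have hB := hage (age.fg_substructure ((Substructure.fg_closure_singleton m).sup hS))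
  obtain ⟨g, hg⟩ := hM _ hB S (S.fg_iff_structure_fg.1 hS) (Substructure.inclusion le_sup_right) f
  exact ⟨g, hg.symm⟩

theorem IsRich.subset_age [hK : IsFraisse K] {M : Type w} [L.Structure M] (hM : IsRich K M)
    (hage : L.age M ⊆ K) : K ⊆ L.age M := by
  intro N hN
  let S : L.Substructure M := Substructure.closure L ∅
  have hS : S.FG := Substructure.fg_closure Set.finite_empty
  obtain ⟨Q, hQ, ⟨i⟩, ⟨j⟩⟩ := hK.jointEmbedding _ (hage (age.fg_substructure hS)) N hN
  obtain ⟨e, -⟩ := hM Q hQ S (S.fg_iff_structure_fg.1 hS) i S.subtype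
  exact ⟨hK.FG N hN, ⟨e.comp j⟩⟩

theorem exists_isFraisseLimit [Countable (Σ l, L.Functions l)] [hK : IsFraisse K]
    (hfin : ∀ N ∈ K, Finite N) :
    ∃ (M : Type w) (_ : L.Structure M) (_ : Countable M), IsFraisseLimit K M := by
  obtain ⟨G, f, hG⟩ := exists_absorbing_chain hfin
  let M := Language.DirectLimit (fun n => (G n).1) (DirectedSystem.natLERec f)
  have hrich : IsRich K M := isRich_directLimit hG
  have hcg : CG L M := Language.DirectLimit.cg _ fun n => (hK.FG _ (G n).2).cg
  have hage : L.age M ⊆ K := by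
    rintro N ⟨hN, ⟨e⟩⟩
    obtain ⟨n, e₀, -⟩ := exists_comp_eq_of_embedding_directLimit hN e
    exact hK.hereditary _ (G n).2 ⟨hN, ⟨e₀⟩⟩
  have : Countable M := cg_iff_countable.1 hcg
  exact ⟨M, inferInstance, this, hrich.isUltrahomogeneous hage hcg,
    hage.antisymm (hrich.subset_age hage)⟩

end FraisseLimit

section FiniteModels

theorem finite_structure_of_finite [Finite (Σ l, L.Functions l)] [Finite (Σ k, L.Relations k)]
    (X : Type*) [Finite X] : Finite (L.Structure X) := by
  refine Finite.of_injective
    (β := (∀ f : Σ l, L.Functions l, (Fin f.1 → X) → X) ×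
      (∀ r : Σ k, L.Relations k, (Fin r.1 → X) → Prop))
    (fun S => (fun f => S.funMap f.2, fun r => S.RelMap r.2)) fun S S' h => ?_
  rw [Prod.mk.injEq] at h
  ext n f x
  · exact congrFun (congrFun h.1 ⟨n, f⟩) x
  · exact (congrFun (congrFun h.2 ⟨n, f⟩) x).to_iff

theorem countable_image_quotient_of_finite [Finite (Σ l, L.Functions l)]
    [Finite (Σ k, L.Relations k)] {K : Set (Bundled.{w} L.Structure)} (hfin : ∀ N ∈ K, Finite N) :
    (Quotient.mk' '' K).Countable := by
  have := fun k => finite_structure_of_finite (L := L) (ULift.{w} (Fin k))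
  refine (Set.countable_range fun p : Σ k, L.Structure (ULift.{w} (Fin k)) =>
    (Quotient.mk' (Bundled.mk _ p.2) : Quotient (equivSetoid (L := L)))).mono ?_
  rintro _ ⟨N, hN, rfl⟩
  have := hfin N hN
  let e : N ≃ ULift.{w} (Fin (Nat.card N)) := (Finite.equivFin N).trans Equiv.ulift.symm
  exact ⟨⟨_, e.inducedStructure⟩, Quotient.sound ⟨(Equiv.bundledInducedEquiv L e).symm⟩⟩

theorem jointEmbedding_of_amalgamation {K : Set (Bundled.{w} L.Structure)} (h : Amalgamation K)
    {C : Bundled.{w} L.Structure} (hC : C ∈ K) (hinit : ∀ N ∈ K, Nonempty (C ↪[L] N)) :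
    JointEmbedding K := by
  intro A hA B hB
  obtain ⟨f⟩ := hinit A hA
  obtain ⟨g⟩ := hinit B hB
  obtain ⟨D, i, j, hD, -⟩ := h C A B f g hC hA hB
  exact ⟨D, hD, ⟨i⟩, ⟨j⟩⟩

variable {T : L.Theory}

theorem amalgamation_of_superamalgamation {le : ∀ (M : Type w) [L.Structure M], M → M → Prop}
    (h : Superamalgamation T le) : Amalgamation {N : Bundled.{w} L.Structure | N ⊨ T} := by
  intro C A B f g hC hA hB
  obtain ⟨D, h, k, hD, hfg, -⟩ := h A B C hA hB hC f g
  exact ⟨D, h, k, hD, Embedding.ext hfg⟩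

variable [T.IsUniversal]
  (hulf : ∀ (N : Type w) [L.Structure N], N ⊨ T → UniformlyLocallyFinite L N)

include hulf

theorem amalgamation_finiteModels (h : Amalgamation {N : Bundled.{w} L.Structure | N ⊨ T}) :
    Amalgamation (finiteModels.{u, v, w} T) := by
  rintro C A B f g ⟨-, hC⟩ ⟨_, hA⟩ ⟨_, hB⟩
  obtain ⟨D, h, k, hD, hfg⟩ := h C A B f g hC hA hB
  have : D ⊨ T := hD
  let S := h.toHom.range ⊔ k.toHom.range
  have hS : S.FG := ((FG.of_finite).range h.toHom).sup ((FG.of_finite).range k.toHom)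
  refine ⟨Bundled.mk S,
    h.codRestrict S fun a => (le_sup_left : h.toHom.range ≤ S) ⟨a, rfl⟩,
    k.codRestrict S fun b => (le_sup_right : k.toHom.range ≤ S) ⟨b, rfl⟩,
    ⟨(hulf D hD).finite_of_fg hS, inferInstance⟩, ?_⟩
  exact Embedding.ext fun c => Subtype.ext (DFunLike.congr_fun hfg c)

theorem isFraisse_finiteModels [Finite (Σ l, L.Functions l)] [Finite (Σ k, L.Relations k)]
    (h : Amalgamation {N : Bundled.{w} L.Structure | N ⊨ T})
    {C : Bundled.{w} L.Structure} (hC : C ∈ finiteModels T)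
    (hinit : ∀ N : Bundled.{w} L.Structure, N ⊨ T → Nonempty (C ↪[L] N)) :
    IsFraisse (finiteModels.{u, v, w} T) where
  is_nonempty := ⟨C, hC⟩
  FG := fun _ ⟨_, _⟩ => FG.of_finite
  is_essentially_countable := countable_image_quotient_of_finite fun _ hN => hN.1
  hereditary := fun _ ⟨_, _⟩ _ ⟨_, ⟨e⟩⟩ =>
    ⟨Finite.of_injective e e.injective, Theory.IsUniversal.models_of_embedding e⟩
  jointEmbedding := jointEmbedding_of_amalgamation (amalgamation_finiteModels hulf h) hC
    fun N hN => hinit N hN.2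
  amalgamation := amalgamation_finiteModels hulf h

variable [Countable (Σ l, L.Functions l)]

theorem exists_embedding_model_completeTheory_of_isFraisseLimit {M : Type w} [L.Structure M]
    [Countable M] [Nonempty M] (hM : IsFraisseLimit (finiteModels.{u, v, w} T) M)
    (A : Theory.ModelType.{u, v, w} T) :
    ∃ N : Theory.ModelType.{u, v, w} (L.completeTheory M), Nonempty (A ↪[L] N) :=
  exists_embedding_model_completeTheory fun S hS => by
    have hSK : Bundled.mk S ∈ finiteModels.{u, v, w} T :=
      ⟨(hulf A A.is_model).finite_of_fg hS, inferInstance⟩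
    exact (hM.age.superset hSK).2

theorem exists_isFraisseLimit_isModelCompletion [Finite (Σ k, L.Relations k)]
    [IsFraisse (finiteModels.{u, v, w} T)]
    (hlarge : ∀ n : ℕ, ∃ B ∈ finiteModels.{u, v, w} T, n < Nat.card B) :
    ∃ (M : Type w) (_ : L.Structure M) (_ : Countable M),
      IsFraisseLimit (finiteModels.{u, v, w} T) M ∧
      Theory.IsOmegaCategorical.{u, v, w} (L.completeTheory M) ∧
      Theory.HasQuantifierElimination (L.completeTheory M) ∧
      Theory.IsModelCompletion.{u, v, w} (L.completeTheory M) T := by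
  obtain ⟨M, _, _, hM⟩ := exists_isFraisseLimit (K := finiteModels.{u, v, w} T) fun N hN => hN.1
  have hMT : M ⊨ T := model_of_forall_fg_model fun S hS =>
    (hM.age.subset (age.fg_substructure hS)).2
  have : Infinite M := by
    refine not_finite_iff_infinite.1 fun _ => ?_
    obtain ⟨B, hB, hcard⟩ := hlarge (Nat.card M)
    obtain ⟨e⟩ := (hM.age.superset hB).2
    exact hcard.not_ge (Nat.card_le_card_of_injective e e.injective)
  have hQE := hasQuantifierElimination_of_isUltrahomogeneous hM.ultrahomogeneous (hulf M hMT)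
  have hembed := exists_embedding_model_completeTheory_of_isFraisseLimit hulf hM
  refine ⟨M, _, _, hM, isOmegaCategorical_of_hasQuantifierElimination hQE (hulf M hMT), hQE, ?_⟩
  refine ⟨fun φ hφ => Theory.models_sentence_of_mem (hMT.realize_of_mem φ hφ),
    isModelComplete_of_hasQuantifierElimination hQE, hembed, fun A => ?_⟩
  obtain ⟨N, ⟨e⟩⟩ := hembed A
  exact isComplete_diagram_of_hasQuantifierElimination hQE e

end FiniteModels

end Fraisse

/-- Contact⁻ posets, as ordered types with a minimum. `InContact a b` stands for `a δ b`. -/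
class ContactOrder (P : Type*) extends PartialOrder P, OrderBot P where
  InContact : P → P → Prop
  inContact_symm : ∀ {a b : P}, InContact a b → InContact b a
  ne_bot_of_inContact : ∀ {a b : P}, InContact a b → a ≠ ⊥
  inContact_mono : ∀ {a b a₁ b₁ : P}, InContact a b → a ≤ a₁ → b ≤ b₁ → InContact a₁ b₁
  inContact_self : ∀ {a : P}, a ≠ ⊥ → InContact a a

/-- Contact⁻ semilattices, as ordered types with a minimum and binary suprema. -/
class ContactSemilatticeSup (P : Type*) extends SemilatticeSup P, ContactOrder P

namespace ContactOrder

section IsContactEmbedding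

variable {P Q : Type*} [ContactOrder P] [ContactOrder Q]

/-- Embeddings of contact⁻ posets. -/
structure IsContactEmbedding (f : P → Q) : Prop where
  map_bot : f ⊥ = ⊥
  le_iff_le : ∀ {a b : P}, f a ≤ f b ↔ a ≤ b
  inContact_iff : ∀ {a b : P}, InContact (f a) (f b) ↔ InContact a b

theorem IsContactEmbedding.injective {f : P → Q} (hf : IsContactEmbedding f) :
    Function.Injective f := fun _ _ h =>
  le_antisymm (hf.le_iff_le.1 h.le) (hf.le_iff_le.1 h.ge)

theorem isContactEmbedding_const_bot [Subsingleton P] :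
    IsContactEmbedding (fun _ => ⊥ : P → Q) where
  map_bot := rfl
  le_iff_le := iff_of_true le_rfl (Subsingleton.elim _ _).le
  inContact_iff := iff_of_false (fun h => ne_bot_of_inContact h rfl)
    fun h => ne_bot_of_inContact h (Subsingleton.elim _ _)

end IsContactEmbedding

/-- The largest contact relation on a semilattice: any two nonzero elements are in contact. -/
abbrev contactSemilatticeSupOfNeBot (P : Type*) [SemilatticeSup P] [OrderBot P] :
    ContactSemilatticeSup P where
  InContact a b := a ≠ ⊥ ∧ b ≠ ⊥
  inContact_symm := And.symm
  ne_bot_of_inContact := And.left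
  inContact_mono h ha hb := ⟨ne_bot_of_le_ne_bot h.1 ha, ne_bot_of_le_ne_bot h.2 hb⟩
  inContact_self h := ⟨h, h⟩

/-- A commutative square of ordered types is a superamalgam if each inequality between elements of
`A` and `B` is witnessed by an element of `C`. -/
structure IsSuperamalgam {A B C D : Type*} [LE A] [LE B] [LE D] (f : C → A) (g : C → B) (h : A → D)
    (k : B → D) : Prop where
  comm : ∀ c, h (f c) = k (g c)
  exists_of_le : ∀ {a b}, h a ≤ k b → ∃ c, a ≤ f c ∧ g c ≤ b
  exists_of_ge : ∀ {a b}, k b ≤ h a → ∃ c, b ≤ g c ∧ f c ≤ a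

section Amalgam

variable {A : Type v} {B : Type w} {C : Type*} [ContactOrder A] [ContactOrder B]
  {f : C → A} {g : C → B} {X : LowerSet A × LowerSet B}

/-- Two lower sets, of `A` and of `B`, are compatible if they contain the minima and have the same
trace on `C`. Ordered by inclusion, compatible pairs amalgamate `A` and `B` over `C`. -/
structure IsCompatible (f : C → A) (g : C → B) (X : LowerSet A × LowerSet B) : Prop where
  bot_mem_left : ⊥ ∈ X.1
  bot_mem_right : ⊥ ∈ X.2
  trace : ∀ c, f c ∈ X.1 ↔ g c ∈ X.2

theorem IsCompatible.swap (h : IsCompatible f g X) : IsCompatible g f X.swap :=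
  ⟨h.bot_mem_right, h.bot_mem_left, fun c => (h.trace c).symm⟩

theorem IsCompatible.Iic_bot_le (h : IsCompatible f g X) : (LowerSet.Iic ⊥, LowerSet.Iic ⊥) ≤ X :=
  Prod.mk_le_mk.2 ⟨LowerSet.Iic_le.2 h.bot_mem_left, LowerSet.Iic_le.2 h.bot_mem_right⟩

/-- The smallest compatible pair whose first component contains `a`. -/
def inl (f : C → A) (g : C → B) (a : A) : LowerSet A × LowerSet B :=
  (LowerSet.Iic a, lowerClosure (g '' {c | f c ≤ a}))

/-- The smallest compatible pair whose second component contains `b`. -/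
def inr (f : C → A) (g : C → B) (b : B) : LowerSet A × LowerSet B :=
  (inl g f b).swap

theorem mem_inl_left {a a' : A} : a' ∈ (inl f g a).1 ↔ a' ≤ a :=
  LowerSet.mem_Iic_iff

theorem mem_inl_right {a : A} {b : B} : b ∈ (inl f g a).2 ↔ ∃ c, b ≤ g c ∧ f c ≤ a := by
  simp [inl, and_comm]

theorem IsCompatible.inl_le_iff (hX : IsCompatible f g X) {a : A} :
    inl f g a ≤ X ↔ a ∈ X.1 := by
  refine ⟨fun h => h.1 (mem_inl_left.2 le_rfl), fun ha => ⟨LowerSet.Iic_le.2 ha, fun b hb => ?_⟩⟩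
  obtain ⟨c, hbc, hca⟩ := mem_inl_right.1 hb
  exact X.2.lower hbc ((hX.trace c).1 (X.1.lower hca ha))

theorem IsCompatible.inr_le_iff (hX : IsCompatible f g X) {b : B} : inr f g b ≤ X ↔ b ∈ X.2 :=
  and_comm.trans hX.swap.inl_le_iff

/-- Two pairs of lower sets are in contact if their first components or their second components
contain elements which are in contact. -/
def PairInContact (X Y : LowerSet A × LowerSet B) : Prop :=
  (∃ a ∈ X.1, ∃ a' ∈ Y.1, InContact a a') ∨ ∃ b ∈ X.2, ∃ b' ∈ Y.2, InContact b b'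

theorem eq_Iic_bot_of_not_pairInContact_self (hX : IsCompatible f g X)
    (h : ¬PairInContact X X) : X = (LowerSet.Iic ⊥, LowerSet.Iic ⊥) := by
  refine le_antisymm (Prod.le_def.2 ⟨fun a ha => ?_, fun b hb => ?_⟩) hX.Iic_bot_le
  · by_contra hne
    exact h (.inl ⟨a, ha, a, ha, inContact_self fun h => hne h.le⟩)
  · by_contra hne
    exact h (.inr ⟨b, hb, b, hb, inContact_self fun h => hne h.le⟩)

/-- The contact⁻ poset formed by a class of compatible pairs. -/
abbrev contactOrderSubtype {p : LowerSet A × LowerSet B → Prop}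
    (hp : ∀ X, p X → IsCompatible f g X) (hbot : p (LowerSet.Iic ⊥, LowerSet.Iic ⊥)) :
    ContactOrder {X // p X} where
  bot := ⟨_, hbot⟩
  bot_le X := (hp _ X.2).Iic_bot_le
  InContact X Y := PairInContact X.1 Y.1
  inContact_symm h := h.imp (fun ⟨u, hu, v, hv, h⟩ => ⟨v, hv, u, hu, inContact_symm h⟩)
    fun ⟨u, hu, v, hv, h⟩ => ⟨v, hv, u, hu, inContact_symm h⟩
  ne_bot_of_inContact := by
    rintro X Y (⟨u, hu, _, _, h⟩ | ⟨u, hu, _, _, h⟩) rfl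
    · exact ne_bot_of_inContact h (le_bot_iff.1 hu)
    · exact ne_bot_of_inContact h (le_bot_iff.1 hu)
  inContact_mono h hX hY := h.imp (fun ⟨u, hu, v, hv, h⟩ => ⟨u, hX.1 hu, v, hY.1 hv, h⟩)
    fun ⟨u, hu, v, hv, h⟩ => ⟨u, hX.2 hu, v, hY.2 hv, h⟩
  inContact_self hX := by
    by_contra h
    exact hX (Subtype.ext (eq_Iic_bot_of_not_pairInContact_self (hp _ (Subtype.property _)) h))

variable [ContactOrder C]

theorem isCompatible_inl (hf : IsContactEmbedding f) (hg : IsContactEmbedding g) (a : A) :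
    IsCompatible f g (inl f g a) where
  bot_mem_left := mem_inl_left.2 bot_le
  bot_mem_right := mem_inl_right.2 ⟨⊥, bot_le, hf.map_bot.trans_le bot_le⟩
  trace c := by
    rw [mem_inl_left, mem_inl_right]
    refine ⟨fun h => ⟨c, le_rfl, h⟩, fun ⟨c', hcc', hc'⟩ => ?_⟩
    exact (hf.le_iff_le.2 (hg.le_iff_le.1 hcc')).trans hc'

theorem isCompatible_inr (hf : IsContactEmbedding f) (hg : IsContactEmbedding g) (b : B) :
    IsCompatible f g (inr f g b) :=
  (isCompatible_inl hg hf b).swap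

theorem inl_comp_eq_inr_comp (hf : IsContactEmbedding f) (hg : IsContactEmbedding g) (c : C) :
    inl f g (f c) = inr f g (g c) :=
  le_antisymm ((isCompatible_inr hf hg _).inl_le_iff.2 (mem_inl_right.2 ⟨c, le_rfl, le_rfl⟩))
    ((isCompatible_inl hf hg _).inr_le_iff.2 (mem_inl_right.2 ⟨c, le_rfl, le_rfl⟩))

theorem inl_bot (hf : IsContactEmbedding f) (hg : IsContactEmbedding g) :
    inl f g ⊥ = (LowerSet.Iic ⊥, LowerSet.Iic ⊥) := by
  have h := inl_comp_eq_inr_comp hf hg ⊥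
  rw [hf.map_bot, hg.map_bot] at h
  exact Prod.ext rfl (congrArg Prod.snd h :)

theorem pairInContact_inl (hf : IsContactEmbedding f) (hg : IsContactEmbedding g) {a a' : A} :
    PairInContact (inl f g a) (inl f g a') ↔ InContact a a' := by
  refine ⟨?_, fun h => .inl ⟨a, mem_inl_left.2 le_rfl, a', mem_inl_left.2 le_rfl, h⟩⟩
  rintro (⟨u, hu, v, hv, huv⟩ | ⟨u, hu, v, hv, huv⟩)
  · exact inContact_mono huv (mem_inl_left.1 hu) (mem_inl_left.1 hv)
  · obtain ⟨c, huc, hca⟩ := mem_inl_right.1 hu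
    obtain ⟨c', hvc', hca'⟩ := mem_inl_right.1 hv
    have hcc' : InContact c c' := hg.inContact_iff.1 (inContact_mono huv huc hvc')
    exact inContact_mono (hf.inContact_iff.2 hcc') hca hca'

theorem pairInContact_inr (hf : IsContactEmbedding f) (hg : IsContactEmbedding g) {b b' : B} :
    PairInContact (inr f g b) (inr f g b') ↔ InContact b b' :=
  or_comm.trans (pairInContact_inl hg hf)

section Subtype

variable {p : LowerSet A × LowerSet B → Prop} (hf : IsContactEmbedding f)
  (hg : IsContactEmbedding g) (hp : ∀ X, p X → IsCompatible f g X)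
  (hbot : p (LowerSet.Iic ⊥, LowerSet.Iic ⊥)) (hinl : ∀ a, p (inl f g a))
  (hinr : ∀ b, p (inr f g b))

include hf hg

theorem isContactEmbedding_inl :
    letI := contactOrderSubtype hp hbot
    IsContactEmbedding fun a => (⟨inl f g a, hinl a⟩ : {X // p X}) :=
  letI := contactOrderSubtype hp hbot
  { map_bot := Subtype.ext (inl_bot hf hg)
    le_iff_le := (hp _ (hinl _)).inl_le_iff
    inContact_iff := pairInContact_inl hf hg }

theorem isContactEmbedding_inr :
    letI := contactOrderSubtype hp hbot
    IsContactEmbedding fun b => (⟨inr f g b, hinr b⟩ : {X // p X}) :=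
  letI := contactOrderSubtype hp hbot
  { map_bot := Subtype.ext (congrArg Prod.swap (inl_bot hg hf))
    le_iff_le := (hp _ (hinr _)).inr_le_iff
    inContact_iff := pairInContact_inr hf hg }

theorem isSuperamalgam_inl_inr :
    IsSuperamalgam f g (fun a => (⟨inl f g a, hinl a⟩ : {X // p X}))
      fun b => ⟨inr f g b, hinr b⟩ where
  comm c := Subtype.ext (inl_comp_eq_inr_comp hf hg c)
  exists_of_le h := mem_inl_right.1 ((isCompatible_inr hf hg _).inl_le_iff.1 h)
  exists_of_ge h := mem_inl_right.1 ((isCompatible_inl hf hg _).inr_le_iff.1 h)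

end Subtype

theorem IsSuperamalgam.exists_of_eq {D : Type*} [Preorder D] {h : A → D} {k : B → D}
    (H : IsSuperamalgam f g h k) (hf : IsContactEmbedding f) (hg : IsContactEmbedding g) {a : A}
    {b : B} (hab : h a = k b) : ∃ c, f c = a ∧ g c = b := by
  obtain ⟨c, hac, hcb⟩ := H.exists_of_le hab.le
  obtain ⟨c', hbc', hca'⟩ := H.exists_of_ge hab.ge
  obtain rfl : c = c' := le_antisymm (hg.le_iff_le.1 (hcb.trans hbc'))
    (hf.le_iff_le.1 (hca'.trans hac))
  exact ⟨c, hca'.antisymm hac, hcb.antisymm hbc'⟩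

theorem exists_isSuperamalgam (hf : IsContactEmbedding f) (hg : IsContactEmbedding g) :
    ∃ (D : Type (max v w)) (_ : ContactOrder D) (h : A → D) (k : B → D),
      IsContactEmbedding h ∧ IsContactEmbedding k ∧ IsSuperamalgam f g h k := by
  have hinl := isCompatible_inl hf hg
  have hinr := isCompatible_inr hf hg
  have hbot := inl_bot hf hg ▸ hinl ⊥
  exact ⟨_, contactOrderSubtype (fun _ => id) hbot, _, _,
    isContactEmbedding_inl hf hg _ hbot hinl, isContactEmbedding_inr hf hg _ hbot hinr,
    isSuperamalgam_inl_inr hf hg hinl hinr⟩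

end Amalgam

section AmalgamSup

variable {A : Type v} {B : Type w} {C : Type*} [ContactSemilatticeSup A] [ContactSemilatticeSup B]
  {f : C → A} {g : C → B} {X : LowerSet A × LowerSet B}

/-- Compatible pairs of ideals. Unlike compatible pairs of lower sets, they amalgamate `A` and `B`
without destroying suprema. -/
structure IsCompatibleIdeal (f : C → A) (g : C → B) (X : LowerSet A × LowerSet B) : Prop
    extends IsCompatible f g X where
  supClosed_left : SupClosed (X.1 : Set A)
  supClosed_right : SupClosed (X.2 : Set B)

theorem IsCompatibleIdeal.swap (h : IsCompatibleIdeal f g X) : IsCompatibleIdeal g f X.swap :=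
  ⟨h.toIsCompatible.swap, h.supClosed_right, h.supClosed_left⟩

theorem IsCompatibleIdeal.inl_sup_le_iff (hX : IsCompatibleIdeal f g X) {a a' : A} :
    inl f g (a ⊔ a') ≤ X ↔ inl f g a ≤ X ∧ inl f g a' ≤ X := by
  simp only [hX.inl_le_iff]
  exact ⟨fun h => ⟨X.1.lower le_sup_left h, X.1.lower le_sup_right h⟩,
    fun h => hX.supClosed_left h.1 h.2⟩

theorem IsCompatibleIdeal.inr_sup_le_iff (hX : IsCompatibleIdeal f g X) {b b' : B} :
    inr f g (b ⊔ b') ≤ X ↔ inr f g b ≤ X ∧ inr f g b' ≤ X := by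
  simp only [hX.inr_le_iff]
  exact ⟨fun h => ⟨X.2.lower le_sup_left h, X.2.lower le_sup_right h⟩,
    fun h => hX.supClosed_right h.1 h.2⟩

theorem isCompatibleIdeal_sInf {S : Set (LowerSet A × LowerSet B)}
    (h : ∀ X ∈ S, IsCompatibleIdeal f g X) : IsCompatibleIdeal f g (sInf S) := by
  have mem_left (a : A) : a ∈ (sInf S).1 ↔ ∀ X ∈ S, a ∈ X.1 := by
    simp only [Prod.fst_sInf, LowerSet.mem_sInf_iff, Set.forall_mem_image]
  have mem_right (b : B) : b ∈ (sInf S).2 ↔ ∀ X ∈ S, b ∈ X.2 := by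
    simp only [Prod.snd_sInf, LowerSet.mem_sInf_iff, Set.forall_mem_image]
  refine ⟨⟨?_, ?_, fun c => ?_⟩, fun a ha a' ha' => ?_, fun b hb b' hb' => ?_⟩
  · exact (mem_left _).2 fun X hX => (h X hX).bot_mem_left
  · exact (mem_right _).2 fun X hX => (h X hX).bot_mem_right
  · exact (mem_left _).trans ((forall₂_congr fun X hX => (h X hX).trace c).trans (mem_right _).symm)
  · exact (mem_left _).2 fun X hX =>
      (h X hX).supClosed_left ((mem_left _).1 ha X hX) ((mem_left _).1 ha' X hX)
  · exact (mem_right _).2 fun X hX =>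
      (h X hX).supClosed_right ((mem_right _).1 hb X hX) ((mem_right _).1 hb' X hX)

variable [ContactSemilatticeSup C]

theorem isCompatibleIdeal_inl (hf : IsContactEmbedding f) (hg : IsContactEmbedding g)
    (hf_sup : ∀ a b, f (a ⊔ b) = f a ⊔ f b) (hg_sup : ∀ a b, g (a ⊔ b) = g a ⊔ g b) (a : A) :
    IsCompatibleIdeal f g (inl f g a) where
  toIsCompatible := isCompatible_inl hf hg a
  supClosed_left _ hu _ hv := mem_inl_left.2 (sup_le (mem_inl_left.1 hu) (mem_inl_left.1 hv))
  supClosed_right u hu v hv := by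
    obtain ⟨c, huc, hca⟩ := mem_inl_right.1 hu
    obtain ⟨d, hvd, hda⟩ := mem_inl_right.1 hv
    refine mem_inl_right.2 ⟨c ⊔ d, ?_, ?_⟩
    · exact (sup_le_sup huc hvd).trans_eq (hg_sup c d).symm
    · exact (hf_sup c d).trans_le (sup_le hca hda)

/-- The contact⁻ semilattice formed by the compatible pairs of ideals. -/
abbrev contactSemilatticeSupSubtype
    (hbot : IsCompatibleIdeal f g (LowerSet.Iic ⊥, LowerSet.Iic ⊥)) :
    ContactSemilatticeSup {X // IsCompatibleIdeal f g X} :=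
  { (ClosureOperator.ofCompletePred _ fun _ => isCompatibleIdeal_sInf).gi.liftSemilatticeSup,
    contactOrderSubtype (fun _ => IsCompatibleIdeal.toIsCompatible) hbot with }

theorem exists_isSuperamalgam_sup (hf : IsContactEmbedding f) (hg : IsContactEmbedding g)
    (hf_sup : ∀ a b, f (a ⊔ b) = f a ⊔ f b) (hg_sup : ∀ a b, g (a ⊔ b) = g a ⊔ g b) :
    ∃ (D : Type (max v w)) (_ : ContactSemilatticeSup D) (h : A → D) (k : B → D),
      IsContactEmbedding h ∧ (∀ a a', h (a ⊔ a') = h a ⊔ h a') ∧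
      IsContactEmbedding k ∧ (∀ b b', k (b ⊔ b') = k b ⊔ k b') ∧ IsSuperamalgam f g h k := by
  have hinl := isCompatibleIdeal_inl hf hg hf_sup hg_sup
  have hinr (b : B) : IsCompatibleIdeal f g (inr f g b) :=
    (isCompatibleIdeal_inl hg hf hg_sup hf_sup b).swap
  have hbot := inl_bot hf hg ▸ hinl ⊥
  have hp (X) (hX : IsCompatibleIdeal f g X) : IsCompatible f g X := hX.toIsCompatible
  let := contactSemilatticeSupSubtype hbot
  refine ⟨_, contactSemilatticeSupSubtype hbot, fun a => ⟨_, hinl a⟩, fun b => ⟨_, hinr b⟩,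
    isContactEmbedding_inl hf hg hp hbot hinl, fun a a' => eq_of_forall_ge_iff fun X => ?_,
    isContactEmbedding_inr hf hg hp hbot hinr, fun b b' => eq_of_forall_ge_iff fun X => ?_,
    isSuperamalgam_inl_inr hf hg hinl hinr⟩
  · rw [sup_le_iff]; exact X.2.inl_sup_le_iff
  · rw [sup_le_iff]; exact X.2.inr_sup_le_iff

end AmalgamSup

end ContactOrder

namespace ContactPoset

open Structure ContactOrder

instance : Finite (Σ l, lang.Functions l) :=
  Finite.of_injective (fun _ => ()) (by rintro ⟨_, ⟨⟩⟩ ⟨_, ⟨⟩⟩ _; rfl)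

instance : Finite (Σ k, lang.Relations k) :=
  Finite.of_surjective (fun b : Bool => if b then ⟨2, Rel.le⟩ else ⟨2, Rel.contact⟩) (by
    rintro ⟨_, _ | _⟩
    exacts [⟨true, rfl⟩, ⟨false, rfl⟩])

instance : theory.IsUniversal := ⟨by
  intro φ hφ
  have hle {n : ℕ} (s t : lang.Term (Empty ⊕ Fin n)) : (leF s t).IsQF :=
    (BoundedFormula.IsAtomic.rel _ _).isQF
  have hcon {n : ℕ} (s t : lang.Term (Empty ⊕ Fin n)) : (conF s t).IsQF :=
    (BoundedFormula.IsAtomic.rel _ _).isQF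
  have heq {n : ℕ} (s t : lang.Term (Empty ⊕ Fin n)) : (s =' t).IsQF :=
    (BoundedFormula.IsAtomic.equal _ _).isQF
  have hlt {n : ℕ} (s t : lang.Term (Empty ⊕ Fin n)) : (ltF s t).IsQF :=
    (hle s t).inf (heq s t).not
  simp only [theory, Set.mem_insert_iff, Set.mem_singleton_iff] at hφ
  rcases hφ with rfl | rfl | rfl | rfl | rfl | rfl | rfl | rfl
  · exact (hle _ _).isUniversal.all
  · exact (((hle _ _).inf (hle _ _)).imp (hle _ _)).isUniversal.all.all.all
  · exact (((hle _ _).inf (hle _ _)).imp (heq _ _)).isUniversal.all.all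
  · exact (hle _ _).isUniversal.all
  · exact (((hcon _ _).imp (hcon _ _)).inf ((hcon _ _).imp (hcon _ _))).isUniversal.all.all
  · exact ((hcon _ _).imp ((hlt _ _).inf (hlt _ _))).isUniversal.all.all
  · exact ((((hcon _ _).inf (hle _ _)).inf (hle _ _)).imp (hcon _ _)).isUniversal.all.all.all.all
  · exact ((heq _ _).not.imp (hcon _ _)).isUniversal.all⟩

/-- The first-order structure of `M` is the one given by its minimum, order and contact relation. -/
class Interprets (M : Type w) [lang.Structure M] [ContactOrder M] : Prop where
  funMap_zero : ∀ x : Fin 0 → M, funMap zeroSymb x = ⊥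
  relMap_le : ∀ x : Fin 2 → M, RelMap leSymb x ↔ x 0 ≤ x 1
  relMap_contact : ∀ x : Fin 2 → M, RelMap contactSymb x ↔ InContact (x 0) (x 1)

open Interprets

theorem exists_interprets {M : Type w} [lang.Structure M] (hM : M ⊨ theory) :
    ∃ _ : ContactOrder M, Interprets M := by
  obtain ⟨refl, trans, antisymm, bot, symm, emp, ext, ref⟩ := (model_theory_iff M).1 hM
  let : ContactOrder M :=
    { le := Le M
      le_refl := refl
      le_trans := trans
      le_antisymm := antisymm
      bot := zero M
      bot_le := bot
      InContact := Contact M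
      inContact_symm := (symm _ _).1
      ne_bot_of_inContact := fun h => (emp _ _ h).1.2.symm
      inContact_mono := ext _ _ _ _
      inContact_self := ref _ }
  exact ⟨this, fun x => congrArg _ (Subsingleton.elim _ _),
    fun x => iff_of_eq (congrArg _ (FinVec.etaExpand_eq x).symm),
    fun x => iff_of_eq (congrArg _ (FinVec.etaExpand_eq x).symm)⟩

/-- The first-order structure given by a minimum, an order and a contact relation. -/
abbrev structureOfContactOrder (M : Type w) [ContactOrder M] : lang.Structure M where
  funMap | Func.zero => fun _ => ⊥
  RelMap
    | Rel.le => fun x => x 0 ≤ x 1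
    | Rel.contact => fun x => InContact (x 0) (x 1)

theorem interprets_structureOfContactOrder (M : Type w) [ContactOrder M] :
    letI := structureOfContactOrder M
    Interprets M :=
  letI := structureOfContactOrder M
  ⟨fun _ => rfl, fun _ => Iff.rfl, fun _ => Iff.rfl⟩

section Interprets

variable {M N : Type w} [lang.Structure M] [lang.Structure N] [ContactOrder M] [ContactOrder N]
  [Interprets M] [Interprets N]

theorem zero_eq_bot : zero M = ⊥ :=
  funMap_zero _

theorem le_iff {a b : M} : Le M a b ↔ a ≤ b :=
  relMap_le _

theorem contact_iff {a b : M} : Contact M a b ↔ InContact a b :=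
  relMap_contact _

variable (M) in
theorem model_theory : M ⊨ theory := by
  simp only [model_theory_iff, le_iff, contact_iff, zero_eq_bot]
  refine ⟨le_refl, fun _ _ _ => le_trans, fun _ _ => le_antisymm, fun _ => bot_le,
    fun _ _ => ⟨inContact_symm, inContact_symm⟩, fun _ _ h => ⟨⟨bot_le, ?_⟩, bot_le, ?_⟩,
    fun _ _ _ _ => inContact_mono, fun _ => inContact_self⟩
  · exact (ne_bot_of_inContact h).symm
  · exact (ne_bot_of_inContact (inContact_symm h)).symm

theorem isContactEmbedding (f : M ↪[lang] N) : IsContactEmbedding f where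
  map_bot := by rw [← zero_eq_bot, ← zero_eq_bot]; exact f.map_constants zeroSymb
  le_iff_le {a b} := (relMap_le _).symm.trans ((f.map_rel leSymb ![a, b]).trans (relMap_le _))
  inContact_iff {a b} :=
    (relMap_contact _).symm.trans ((f.map_rel contactSymb ![a, b]).trans (relMap_contact _))

/-- An embedding of contact⁻ posets as a first-order embedding. -/
def embeddingOfIsContactEmbedding {f : M → N} (hf : IsContactEmbedding f) : M ↪[lang] N where
  toFun := f
  inj' := hf.injective
  map_fun' := by
    rintro _ ⟨⟩ x
    exact (congrArg f (funMap_zero x)).trans (hf.map_bot.trans (funMap_zero _).symm)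
  map_rel' := by
    rintro _ ⟨⟩ x
    · exact (relMap_le _).trans (hf.le_iff_le.trans (relMap_le x).symm)
    · exact (relMap_contact _).trans (hf.inContact_iff.trans (relMap_contact x).symm)

theorem realize_term_le_iff {α : Type} [DecidableEq α] (t : lang.Term α) {x : α → M} {c : M} :
    t.realize x ≤ c ↔ ∀ i ∈ t.varFinset, x i ≤ c := by
  cases t with
  | var i => simp [Term.varFinset]
  | func f ts =>
    cases f
    have : Term.realize x (Term.func Func.zero ts : lang.Term α) = ⊥ := funMap_zero _
    simp [this, Term.varFinset]

end Interprets

theorem superamalgamation : Superamalgamation.{0, 0, w} theory Le := by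
  intro A B C hA hB hC f g
  obtain ⟨_, _⟩ := exists_interprets hA
  obtain ⟨_, _⟩ := exists_interprets hB
  obtain ⟨_, _⟩ := exists_interprets hC
  have hf := isContactEmbedding f
  have hg := isContactEmbedding g
  obtain ⟨D, _, h, k, hh, hk, H⟩ := exists_isSuperamalgam hf hg
  let := structureOfContactOrder D
  have := interprets_structureOfContactOrder D
  refine ⟨⟨D, inferInstance⟩, embeddingOfIsContactEmbedding hh, embeddingOfIsContactEmbedding hk,
    model_theory D, H.comm, fun a b => H.exists_of_eq hf hg, fun a b hab => ?_, fun a b hba => ?_⟩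
  · simpa only [le_iff] using H.exists_of_le hab
  · simpa only [le_iff] using H.exists_of_ge hba

theorem uniformlyLocallyFinite (N : Type w) [lang.Structure N] (hN : N ⊨ theory) :
    Fraisse.UniformlyLocallyFinite lang N := by
  obtain ⟨_, _⟩ := exists_interprets hN
  refine .of_varFinset fun α _ s t hst x => eq_of_forall_ge_iff fun c => ?_
  rw [realize_term_le_iff, realize_term_le_iff, hst]

theorem exists_mem_finiteModels (M : Type w) [Finite M] [SemilatticeSup M] [OrderBot M] :
    ∃ S : lang.Structure M, Bundled.mk M S ∈ finiteModels theory := by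
  let := contactSemilatticeSupOfNeBot M
  let := structureOfContactOrder M
  have := interprets_structureOfContactOrder M
  exact ⟨_, ‹_›, model_theory M⟩

theorem nonempty_embedding_of_subsingleton {M N : Type w} [lang.Structure M] [lang.Structure N]
    [Subsingleton M] (hM : M ⊨ theory) (hN : N ⊨ theory) : Nonempty (M ↪[lang] N) := by
  obtain ⟨_, _⟩ := exists_interprets hM
  obtain ⟨_, _⟩ := exists_interprets hN
  exact ⟨embeddingOfIsContactEmbedding isContactEmbedding_const_bot⟩

instance isFraisse_finiteModels : IsFraisse (finiteModels.{0, 0, w} theory) := by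
  obtain ⟨S, hS⟩ := exists_mem_finiteModels PUnit.{w + 1}
  exact Fraisse.isFraisse_finiteModels uniformlyLocallyFinite
    (Fraisse.amalgamation_of_superamalgamation superamalgamation) hS
    fun N hN => nonempty_embedding_of_subsingleton (M := PUnit) hS.2 hN

theorem exists_mem_finiteModels_lt_card (n : ℕ) :
    ∃ B ∈ finiteModels.{0, 0, w} theory, n < Nat.card B := by
  obtain ⟨S, hS⟩ := exists_mem_finiteModels (ULift.{w} (Fin (n + 1)))
  exact ⟨_, hS, by simp⟩

end ContactPoset

namespace ContactSemilattice

open Structure ContactOrder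

instance : Finite (Σ l, lang.Functions l) :=
  Finite.of_surjective (fun b : Bool => if b then ⟨0, Func.zero⟩ else ⟨2, Func.add⟩) (by
    rintro ⟨_, _ | _⟩
    exacts [⟨true, rfl⟩, ⟨false, rfl⟩])

instance : Finite (Σ k, lang.Relations k) :=
  Finite.of_injective (fun _ => ()) (by rintro ⟨_, ⟨⟩⟩ ⟨_, ⟨⟩⟩ _; rfl)

instance : theory.IsUniversal := ⟨by
  intro φ hφ
  have hcon {n : ℕ} (s t : lang.Term (Empty ⊕ Fin n)) : (conF s t).IsQF :=
    (BoundedFormula.IsAtomic.rel _ _).isQF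
  have heq {n : ℕ} (s t : lang.Term (Empty ⊕ Fin n)) : (s =' t).IsQF :=
    (BoundedFormula.IsAtomic.equal _ _).isQF
  have hlt {n : ℕ} (s t : lang.Term (Empty ⊕ Fin n)) : (ltF s t).IsQF :=
    (heq _ _).inf (heq s t).not
  simp only [theory, leF, Set.mem_insert_iff, Set.mem_singleton_iff] at hφ
  rcases hφ with rfl | rfl | rfl | rfl | rfl | rfl | rfl | rfl
  · exact (heq _ _).isUniversal.all.all.all
  · exact (heq _ _).isUniversal.all.all
  · exact (heq _ _).isUniversal.all
  · exact (heq _ _).isUniversal.all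
  · exact (((hcon _ _).imp (hcon _ _)).inf ((hcon _ _).imp (hcon _ _))).isUniversal.all.all
  · exact ((hcon _ _).imp ((hlt _ _).inf (hlt _ _))).isUniversal.all.all
  · exact ((((hcon _ _).inf (heq _ _)).inf (heq _ _)).imp (hcon _ _)).isUniversal.all.all.all.all
  · exact ((heq _ _).not.imp (hcon _ _)).isUniversal.all⟩

/-- The first-order structure of `M` is the one given by its minimum, suprema and contact
relation. -/
class Interprets (M : Type w) [lang.Structure M] [ContactSemilatticeSup M] : Prop where
  funMap_zero : ∀ x : Fin 0 → M, funMap zeroSymb x = ⊥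
  funMap_add : ∀ x : Fin 2 → M, funMap addSymb x = x 0 ⊔ x 1
  relMap_contact : ∀ x : Fin 2 → M, RelMap contactSymb x ↔ InContact (x 0) (x 1)

open Interprets

theorem exists_interprets {M : Type w} [lang.Structure M] (hM : M ⊨ theory) :
    ∃ _ : ContactSemilatticeSup M, Interprets M := by
  obtain ⟨assoc, comm, idem, bot, symm, emp, ext, ref⟩ := (model_theory_iff M).1 hM
  let : Max M := ⟨add M⟩
  let : ContactSemilatticeSup M :=
    { SemilatticeSup.mk' comm assoc idem with
      bot := zero M
      bot_le := bot
      InContact := Contact M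
      inContact_symm := (symm _ _).1
      ne_bot_of_inContact := fun h => (emp _ _ h).1.2.symm
      inContact_mono := ext _ _ _ _
      inContact_self := ref _ }
  exact ⟨this, fun x => congrArg _ (Subsingleton.elim _ _),
    fun x => congrArg _ (FinVec.etaExpand_eq x).symm,
    fun x => iff_of_eq (congrArg _ (FinVec.etaExpand_eq x).symm)⟩

/-- The first-order structure given by a minimum, suprema and a contact relation. -/
abbrev structureOfContactSemilatticeSup (M : Type w) [ContactSemilatticeSup M] :
    lang.Structure M where
  funMap
    | Func.zero => fun _ => ⊥
    | Func.add => fun x => x 0 ⊔ x 1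
  RelMap | Rel.contact => fun x => InContact (x 0) (x 1)

theorem interprets_structureOfContactSemilatticeSup (M : Type w) [ContactSemilatticeSup M] :
    letI := structureOfContactSemilatticeSup M
    Interprets M :=
  letI := structureOfContactSemilatticeSup M
  ⟨fun _ => rfl, fun _ => rfl, fun _ => Iff.rfl⟩

section Interprets

variable {M N : Type w} [lang.Structure M] [lang.Structure N] [ContactSemilatticeSup M]
  [ContactSemilatticeSup N] [Interprets M] [Interprets N]

theorem zero_eq_bot : zero M = ⊥ :=
  funMap_zero _

theorem add_eq_sup {a b : M} : add M a b = a ⊔ b :=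
  funMap_add _

theorem le_iff {a b : M} : Le M a b ↔ a ≤ b := by
  rw [Le, add_eq_sup, sup_eq_right]

theorem contact_iff {a b : M} : Contact M a b ↔ InContact a b :=
  relMap_contact _

variable (M) in
theorem model_theory : M ⊨ theory := by
  simp only [model_theory_iff, le_iff, add_eq_sup, contact_iff, zero_eq_bot]
  refine ⟨sup_assoc, sup_comm, sup_idem, fun _ => bot_le,
    fun _ _ => ⟨inContact_symm, inContact_symm⟩, fun _ _ h => ⟨⟨bot_le, ?_⟩, bot_le, ?_⟩,
    fun _ _ _ _ => inContact_mono, fun _ => inContact_self⟩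
  · exact (ne_bot_of_inContact h).symm
  · exact (ne_bot_of_inContact (inContact_symm h)).symm

theorem map_sup (f : M ↪[lang] N) (a b : M) : f (a ⊔ b) = f a ⊔ f b :=
  (congrArg f (funMap_add ![a, b]).symm).trans
    ((f.map_fun addSymb ![a, b]).trans (funMap_add _))

theorem isContactEmbedding (f : M ↪[lang] N) : IsContactEmbedding f where
  map_bot := by rw [← zero_eq_bot, ← zero_eq_bot]; exact f.map_constants zeroSymb
  le_iff_le {a b} := by rw [← sup_eq_right, ← map_sup, f.injective.eq_iff, sup_eq_right]
  inContact_iff {a b} :=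
    (relMap_contact _).symm.trans ((f.map_rel contactSymb ![a, b]).trans (relMap_contact _))

/-- An embedding of contact⁻ semilattices as a first-order embedding. -/
def embeddingOfIsContactEmbedding {f : M → N} (hf : IsContactEmbedding f)
    (hf_sup : ∀ a b, f (a ⊔ b) = f a ⊔ f b) : M ↪[lang] N where
  toFun := f
  inj' := hf.injective
  map_fun' := by
    rintro _ ⟨⟩ x
    · exact (congrArg f (funMap_zero x)).trans (hf.map_bot.trans (funMap_zero _).symm)
    · exact (congrArg f (funMap_add x)).trans ((hf_sup _ _).trans (funMap_add (f ∘ x)).symm)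
  map_rel' := by
    rintro _ ⟨⟩ x
    exact (relMap_contact _).trans (hf.inContact_iff.trans (relMap_contact x).symm)

theorem realize_term_le_iff {α : Type} [DecidableEq α] (t : lang.Term α) {x : α → M} {c : M} :
    t.realize x ≤ c ↔ ∀ i ∈ t.varFinset, x i ≤ c := by
  induction t with
  | var i => simp [Term.varFinset]
  | func f ts ih =>
    cases f
    · have : Term.realize x (Term.func Func.zero ts : lang.Term α) = ⊥ := funMap_zero _
      simp [this, Term.varFinset]
    · have : Term.realize x (Term.func Func.add ts : lang.Term α) =
          (ts 0).realize x ⊔ (ts 1).realize x := funMap_add _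
      simp [this, ih, Term.varFinset, or_imp, forall_and]

end Interprets

theorem superamalgamation : Superamalgamation.{0, 0, w} theory Le := by
  intro A B C hA hB hC f g
  obtain ⟨_, _⟩ := exists_interprets hA
  obtain ⟨_, _⟩ := exists_interprets hB
  obtain ⟨_, _⟩ := exists_interprets hC
  have hf := isContactEmbedding f
  have hg := isContactEmbedding g
  obtain ⟨D, _, h, k, hh, hh_sup, hk, hk_sup, H⟩ :=
    exists_isSuperamalgam_sup hf hg (map_sup f) (map_sup g)
  let := structureOfContactSemilatticeSup D
  have := interprets_structureOfContactSemilatticeSup D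
  refine ⟨⟨D, inferInstance⟩, embeddingOfIsContactEmbedding hh hh_sup,
    embeddingOfIsContactEmbedding hk hk_sup, model_theory D, H.comm,
    fun a b => H.exists_of_eq hf hg, fun a b hab => ?_, fun a b hba => ?_⟩
  · simpa only [le_iff] using H.exists_of_le (le_iff.1 hab)
  · simpa only [le_iff] using H.exists_of_ge (le_iff.1 hba)

theorem uniformlyLocallyFinite (N : Type w) [lang.Structure N] (hN : N ⊨ theory) :
    Fraisse.UniformlyLocallyFinite lang N := by
  obtain ⟨_, _⟩ := exists_interprets hN
  refine .of_varFinset fun α _ s t hst x => eq_of_forall_ge_iff fun c => ?_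
  rw [realize_term_le_iff, realize_term_le_iff, hst]

theorem exists_mem_finiteModels (M : Type w) [Finite M] [SemilatticeSup M] [OrderBot M] :
    ∃ S : lang.Structure M, Bundled.mk M S ∈ finiteModels theory := by
  let := contactSemilatticeSupOfNeBot M
  let := structureOfContactSemilatticeSup M
  have := interprets_structureOfContactSemilatticeSup M
  exact ⟨_, ‹_›, model_theory M⟩

theorem nonempty_embedding_of_subsingleton {M N : Type w} [lang.Structure M] [lang.Structure N]
    [Subsingleton M] (hM : M ⊨ theory) (hN : N ⊨ theory) : Nonempty (M ↪[lang] N) := by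
  obtain ⟨_, _⟩ := exists_interprets hM
  obtain ⟨_, _⟩ := exists_interprets hN
  exact ⟨embeddingOfIsContactEmbedding isContactEmbedding_const_bot fun _ _ => (sup_idem ⊥).symm⟩

instance isFraisse_finiteModels : IsFraisse (finiteModels.{0, 0, w} theory) := by
  obtain ⟨S, hS⟩ := exists_mem_finiteModels PUnit.{w + 1}
  exact Fraisse.isFraisse_finiteModels uniformlyLocallyFinite
    (Fraisse.amalgamation_of_superamalgamation superamalgamation) hS
    fun N hN => nonempty_embedding_of_subsingleton (M := PUnit) hS.2 hN

theorem exists_mem_finiteModels_lt_card (n : ℕ) :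
    ∃ B ∈ finiteModels.{0, 0, w} theory, n < Nat.card B := by
  obtain ⟨S, hS⟩ := exists_mem_finiteModels (ULift.{w} (Fin (n + 1)))
  exact ⟨_, hS, by simp⟩

end ContactSemilattice

theorem theorem5 :
    (Superamalgamation.{0, 0, w} ContactPoset.theory ContactPoset.Le ∧
      ∃ (M : Type w) (_ : ContactPoset.lang.Structure M) (_ : Countable M),
        IsFraisseLimit (finiteModels.{0, 0, w} ContactPoset.theory) M ∧
        Theory.IsOmegaCategorical.{0, 0, w} (ContactPoset.lang.completeTheory M) ∧
        Theory.HasQuantifierElimination (ContactPoset.lang.completeTheory M) ∧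
        Theory.IsModelCompletion.{0, 0, w} (ContactPoset.lang.completeTheory M)
          ContactPoset.theory) ∧
    (Superamalgamation.{0, 0, w} ContactSemilattice.theory ContactSemilattice.Le ∧
      ∃ (M : Type w) (_ : ContactSemilattice.lang.Structure M) (_ : Countable M),
        IsFraisseLimit (finiteModels.{0, 0, w} ContactSemilattice.theory) M ∧
        Theory.IsOmegaCategorical.{0, 0, w} (ContactSemilattice.lang.completeTheory M) ∧
        Theory.HasQuantifierElimination (ContactSemilattice.lang.completeTheory M) ∧
        Theory.IsModelCompletion.{0, 0, w} (ContactSemilattice.lang.completeTheory M)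
          ContactSemilattice.theory) := by
  refine ⟨⟨ContactPoset.superamalgamation, ?_⟩, ContactSemilattice.superamalgamation, ?_⟩
  · exact Fraisse.exists_isFraisseLimit_isModelCompletion ContactPoset.uniformlyLocallyFinite
      ContactPoset.exists_mem_finiteModels_lt_card
  · exact Fraisse.exists_isFraisseLimit_isModelCompletion ContactSemilattice.uniformlyLocallyFinite
      ContactSemilattice.exists_mem_finiteModels_lt_card
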